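/- **Setting.** Let $b\ge 0$, $d=2^b$, $p=d^2=4^b$, and let $B_1,\dots,B_p$ be the Pauli basis: all tensor products $\sigma_{\ell_1}\otimes\cdots\otimes\sigma_{\ell_b}$, $(\ell_1,\dots,\ell_b)\in\{0,1,2,3\}^b$, where $\sigma_0$ is the $2\times2$ identity and $\sigma_1,\sigma_2,\sigma_3$ are the Pauli matrices. For $B_j$ let $\lambda_{ja}$ be its distinct eigenvalues and $Q_{ja}$ the orthogonal projections onto the corresponding eigenspaces. A density matrix is a positive semidefinite $\rho\in\mathbb C^{d\times d}$ with $\operatorname{tr}\rho=1$; put $\mathcal I_j(\rho)=\{a: 0<\operatorname{tr}(Q_{ja}\rho)<1\}$. Let $\Theta_r$ be the set of density matrices of rank at most $r$, $r\ge1$. For design distributions $\Pi,\Xi$ on $\{1,\dots,p\}$ and a class $\Theta$ of density matrices let $$\zeta_p(\Theta)=\sup_{\rho\in\Theta}\max\Big\{\sum_j\Pi(j)1(|\mathcal I_j(\rho)|\ge2),\ \sum_j\Xi(j)1(|\mathcal I_j(\rho)|\ge2)\Big\}.$$ Throughout $\Pi(j)=\Xi(j)=1/p$. **Experiments.** Fix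 $m\ge1$ and $n$, and draw $n$ independent observations as follows, $j$ always being uniform on $\{1,\dots,p\}$. $\mathcal P_{1n}$ (trace regression): $(B_j,Y)$ where, given $j$, $Y$ is normal with mean $\operatorname{tr}(B_j\rho)$ and variance $\frac1m\{\operatorname{tr}(B_j^2\rho)-[\operatorname{tr}(B_j\rho)]^2\}$. $\mathcal P_{2n}$ (tomography, summarized): $(B_j,(R_1+\cdots+R_m)/m)$ where, given $j$, the $R_l$ are independent with $P(R_l=\lambda_{ja})=\operatorname{tr}(Q_{ja}\rho)$. $\mathcal Q_{1n}$ (fine scale trace regression): $(B_j,(y_a)_a)$ where, given $j$, $(y_a)_a$ is multivariate normal with means $\operatorname{tr}(Q_{ja}\rho)$, variances $\frac1m\operatorname{tr}(Q_{ja}\rho)[1-\operatorname{tr}(Q_{ja}\rho)]$ and covariances $-\frac1m\operatorname{tr}(Q_{ja}\rho)\operatorname{tr}(Q_{jb}\rho)$, $a\ne b$. $\mathcal Q_{2n}$ (tomography, individual): $(B_j,R_1,\dots,R_m)$ with $R_l$ as in $\mathcal P_{2n}$. For experiments $\mathcal E,\mathcal E'$ with the same parameter set $\Theta$ let $$\delta(\mathcal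 E,\mathcal E')=\sup_{\chi'}\inf_{\chi}\sup_{\rho\in\Theta}\sup_{L:\|L\|=1}|R(\chi,L,\rho)-R'(\chi',L,\rho)|,\qquad \Delta=\max\{\delta(\mathcal E,\mathcal E'),\delta(\mathcal E',\mathcal E)\},$$ where $\chi,\chi'$ are randomized decision procedures in $\mathcal E,\mathcal E'$ with a common, arbitrary measurable action space, $L\ge0$ is a loss function with supremum $\|L\|=1$, and $R,R'$ are the risks. **Claim.** (a) For every $r\ge1$ the supremum defining $\zeta_p(\Theta_r)$ is attained and $$1\ \ge\ \zeta_p(\Theta_r)=\max_{\rho\in\Theta_r}\Big\{\frac1p\sum_{j=1}^p1(|\mathcal I_j(\rho)|\ge2)\Big\}\ \ge\ 1-\frac1p .$$ Moreover, with $e=(\sqrt{6/7},\ \sqrt{1/14}+\sqrt{-1}\sqrt{1/14})'$ and $U=e^{\otimes b}$, the matrix $\rho=UU^\dagger$ is a density matrix of rank one for which $\frac1p\sum_j1(|\mathcal I_j(\rho)|\ge2)=1-\frac1p$. (b) For all constants $0<c_0\le c_1<1$ there is a constant $C>0$, depending only on $c_0,c_1$, such that for all $b$, $r$, $n$, all $m\ge1$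 and every class $\Theta\subseteq\Theta_r$ of density matrices satisfying $c_0\le\operatorname{tr}(Q_{ja}\rho)\le c_1$ for all $\rho\in\Theta$, all $j$ and all $a\in\mathcal I_j(\rho)$, $$\Delta(\mathcal P_{1n},\mathcal P_{2n})\le C\Big(\frac nm\Big)^{1/2},\qquad \Delta(\mathcal Q_{1n},\mathcal Q_{2n})\le C\Big(\frac nm\Big)^{1/2},$$ where all four experiments have parameter set $\Theta$. -/

import Mathlib

open MeasureTheory ProbabilityTheory
open scoped ComplexOrder

noncomputable section

namespace QTomo

/-! ### Le Cam's deficiency distance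

A statistical experiment with parameter set `T` is given by its sample space `Ω` and the family
`P : T → Measure Ω` of its laws. A decision procedure with action space `A` is a Markov kernel
from `Ω` to `A`. -/

/-- A loss function `L : T × A → [0, ∞)` (measurable in the action) with `‖L‖ = sup L = 1`. -/
structure IsNormalizedLoss {T A : Type} [MeasurableSpace A] (L : T → A → ℝ) : Prop where
  nonneg : ∀ ρ a, 0 ≤ L ρ a
  measurable : ∀ ρ, Measurable (L ρ)
  sup_eq_one : IsLUB (Set.range fun q : T × A => L q.1 q.2) 1

/-- The risk of the procedure `χ` under the loss `L` at the true parameter value `ρ`. -/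
def risk {T Ω A : Type} [MeasurableSpace Ω] [MeasurableSpace A] (P : T → Measure Ω)
    (χ : Kernel Ω A) (L : T → A → ℝ) (ρ : T) : ℝ :=
  ∫ ω, ∫ a, L ρ a ∂(χ ω) ∂(P ρ)

/-- The deficiency `δ(P, P')` of `P` with respect to `P'`: the smallest `ε` such that every
procedure `χ'` in `P'`, over any measurable action space, has procedures `χ` in `P` whose risk is
within `ε` (up to an arbitrarily small error), uniformly over the parameter and over all losses
with `‖L‖ = 1`. -/
def deficiency {T Ω Ω' : Type} [MeasurableSpace Ω] [MeasurableSpace Ω']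
    (P : T → Measure Ω) (P' : T → Measure Ω') : ENNReal :=
  ⨆ (A : Type) (_ : MeasurableSpace A) (χ' : Kernel Ω' A) (_ : IsMarkovKernel χ'),
    ⨅ (χ : Kernel Ω A) (_ : IsMarkovKernel χ),
      ⨆ (ρ : T) (L : T → A → ℝ) (_ : IsNormalizedLoss L),
        ENNReal.ofReal |risk P χ L ρ - risk P' χ' L ρ|

/-- Le Cam's deficiency distance `Δ`. -/
def deficiencyDist {T Ω Ω' : Type} [MeasurableSpace Ω] [MeasurableSpace Ω']
    (P : T → Measure Ω) (P' : T → Measure Ω') : ENNReal :=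
  max (deficiency P P') (deficiency P' P)

/-! ### States, observables, measurement probabilities -/

section

variable {d : Type} [Fintype d] [DecidableEq d]

/-- Density matrices: positive semidefinite (in particular Hermitian) with unit trace. -/
def IsDensity (ρ : Matrix d d ℂ) : Prop := ρ.PosSemidef ∧ ρ.trace = 1

/-- Density matrices of rank at most `r`. -/
def lowRankStates (d : Type) [Fintype d] [DecidableEq d] (r : ℕ) : Set (Matrix d d ℂ) :=
  {ρ | IsDensity ρ ∧ ρ.rank ≤ r}

/-- `spectrum ℝ A` is the set of the distinct real eigenvalues of `A`. -/
instance instFintypeSpectrum (A : Matrix d d ℂ) : Fintype (spectrum ℝ A) :=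
  Fintype.ofFinite _

/-- The matrix of the orthogonal projection onto the eigenspace of `A` for the eigenvalue `a`. -/
def eigenProj (A : Matrix d d ℂ) (a : ℝ) : Matrix d d ℂ :=
  (Matrix.toEuclideanCLM (n := d) (𝕜 := ℂ)).symm
    (Module.End.eigenspace (Matrix.toEuclideanLin A) (a : ℂ)).starProjection

/-- `tr(Q_a ρ)`, the probability of the outcome `a` when `A` is measured in the state `ρ`. -/
def cellProb (A ρ : Matrix d d ℂ) (a : ℝ) : ℝ := (eigenProj A a * ρ).trace.re

/-- The set `I(ρ)` of the eigenvalues of `A` whose probability lies strictly between 0 and 1. -/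
def properCells (A ρ : Matrix d d ℂ) : Set (spectrum ℝ A) :=
  {a | 0 < cellProb A ρ a ∧ cellProb A ρ a < 1}

/-- The law on `ℝ` of one measurement outcome of `A` in the state `ρ`. -/
def outcomeLaw (A ρ : Matrix d d ℂ) : Measure ℝ :=
  ∑ a : spectrum ℝ A, ENNReal.ofReal (cellProb A ρ a) • Measure.dirac (a : ℝ)

/-- The law of `m` independent measurement outcomes of `A` in the state `ρ`. -/
def individualLaw (m : ℕ) (A ρ : Matrix d d ℂ) : Measure (Fin m → ℝ) :=
  Measure.pi fun _ => outcomeLaw A ρ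

/-- The law of the average of `m` independent measurement outcomes of `A` in the state `ρ`. -/
def averageLaw (m : ℕ) (A ρ : Matrix d d ℂ) : Measure ℝ :=
  (individualLaw m A ρ).map fun R => (∑ l, R l) / m

/-- The conditional law of `Y = tr(Xᴴ ρ) + ε` given `X = A`, where `ε` is centred normal with
variance `(1/m) (tr(A² ρ) - tr(A ρ)²)`. -/
def regressionLaw (m : ℕ) (A ρ : Matrix d d ℂ) : Measure ℝ :=
  gaussianReal (A.conjTranspose * ρ).trace.re
    (((A * A * ρ).trace.re - (A * ρ).trace.re ^ 2) / m).toNNReal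

/-- The covariance matrix of the errors `z_a` in fine scale trace regression. -/
def fineCov (m : ℕ) (A ρ : Matrix d d ℂ) : Matrix (spectrum ℝ A) (spectrum ℝ A) ℝ :=
  Matrix.of fun a b =>
    if a = b then cellProb A ρ a * (1 - cellProb A ρ a) / m
    else -(cellProb A ρ a * cellProb A ρ b) / m

/-- The conditional law of the vector of all `y_a = tr(Q_a ρ) + z_a` given `X = A`, where `z` is
centred multivariate normal with covariance `fineCov`. -/
def fineRegressionLaw (m : ℕ) (A ρ : Matrix d d ℂ) :
    Measure (EuclideanSpace ℝ (spectrum ℝ A)) :=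
  multivariateGaussian (WithLp.toLp 2 fun a : spectrum ℝ A => cellProb A ρ a) (fineCov m A ρ)

end

/-! ### The four experiments under random designs

A family `B : J → Matrix d d ℂ` of Hermitian matrices is given, and a design distribution on `J`.
An observation is a pair of the sampled matrix, recorded through its index `j`, and of data in a
space `S j` (which depends on `j` for the fine scale regression). -/

section

variable {J : Type} [Fintype J]

/-- The law of `(j, s)` where `j` is drawn from `designX` and `s` from `μ j` given `j`. -/
def mixtureLaw (designX : PMF J) {S : J → Type} [∀ j, MeasurableSpace (S j)]
    (μ : ∀ j, Measure (S j)) : Measure (Σ j, S j) :=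
  ∑ j, designX j • (μ j).map (Sigma.mk j)

variable {d : Type} [Fintype d] [DecidableEq d] (B : J → Matrix d d ℂ) (designX designM : PMF J)

/-- `P_{1,n,ρ}`: trace regression, the law of `(X_k, Y_k)`, `k = 1, …, n`. -/
def traceRegression (m n : ℕ) (ρ : Matrix d d ℂ) : Measure (Fin n → Σ _ : J, ℝ) :=
  Measure.pi fun _ => mixtureLaw designX fun j => regressionLaw m (B j) ρ

/-- `P_{2,n,ρ}`: tomography with summarized measurements, the law of `(M_k, N_k)`,
`k = 1, …, n`. -/
def tomographySummarized (m n : ℕ) (ρ : Matrix d d ℂ) : Measure (Fin n → Σ _ : J, ℝ) :=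
  Measure.pi fun _ => mixtureLaw designM fun j => averageLaw m (B j) ρ

/-- `Q_{1,n,ρ}`: fine scale trace regression, the law of `(X_k, (y_{ka})_a)`, `k = 1, …, n`. -/
def fineTraceRegression (m n : ℕ) (ρ : Matrix d d ℂ) :
    Measure (Fin n → Σ j : J, EuclideanSpace ℝ (spectrum ℝ (B j))) :=
  Measure.pi fun _ => mixtureLaw designX fun j => fineRegressionLaw m (B j) ρ

/-- `Q_{2,n,ρ}`: tomography with individual measurements, the law of `(M_k, R_{k1}, …, R_{km})`,
`k = 1, …, n`. -/
def tomographyIndividual (m n : ℕ) (ρ : Matrix d d ℂ) :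
    Measure (Fin n → Σ _ : J, (Fin m → ℝ)) :=
  Measure.pi fun _ => mixtureLaw designM fun j => individualLaw m (B j) ρ

/-- The mass, under the design `designX`, of the `j` with `|I_j(ρ)| ≥ 2`. -/
def nondegenerateMass (ρ : Matrix d d ℂ) : ℝ :=
  ∑ j, (designX j).toReal * (if 2 ≤ (properCells (B j) ρ).ncard then 1 else 0)

/-- `ζ_p`, for the design distributions `designX` (regression) and `designM` (tomography) and the class `Θ`. -/
def zeta (Θ : Set (Matrix d d ℂ)) : ℝ :=
  ⨆ ρ : Θ, max (nondegenerateMass B designX ρ) (nondegenerateMass B designM ρ)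

/-- All cell probabilities other than 0 and 1 of states in `Θ` lie in `[c₀, c₁]`. -/
def CellBounds (c₀ c₁ : ℝ) (Θ : Set (Matrix d d ℂ)) : Prop :=
  ∀ ρ ∈ Θ, ∀ j, ∀ a ∈ properCells (B j) ρ,
    c₀ ≤ cellProb (B j) ρ a ∧ cellProb (B j) ρ a ≤ c₁

end

/-! ### The Pauli basis -/

/-- `σ₀ = I` and the Pauli matrices `σ₁, σ₂, σ₃`. -/
def sigma : Fin 4 → Matrix (Fin 2) (Fin 2) ℂ :=
  ![!![1, 0; 0, 1], !![0, 1; 1, 0], !![0, -Complex.I; Complex.I, 0], !![1, 0; 0, -1]]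

/-- The Pauli basis for `d = 2 ^ b`: `σ_{ℓ₁} ⊗ ⋯ ⊗ σ_{ℓ_b}`, `ℓ ∈ {0, 1, 2, 3}^b`, acting on
`ℂ² ⊗ ⋯ ⊗ ℂ²` with basis indexed by `{0, 1}^b`. -/
def pauli (b : ℕ) (l : Fin b → Fin 4) : Matrix (Fin b → Fin 2) (Fin b → Fin 2) ℂ :=
  Matrix.of fun x y => ∏ i, sigma (l i) (x i) (y i)

/-- The uniform design on the `p = 4 ^ b` elements of the Pauli basis. -/
def unifDesign (b : ℕ) : PMF (Fin b → Fin 4) := PMF.uniformOfFintype _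

/-- The unit vector `e = (√(6/7), √(1/14) + √(1/14) i)` of `ℂ²`. -/
def qubit : Fin 2 → ℂ :=
  ![(Real.sqrt (6 / 7) : ℂ), (Real.sqrt (1 / 14) : ℂ) + (Real.sqrt (1 / 14) : ℂ) * Complex.I]

/-- The state `U Uᴴ` with `U = e ⊗ ⋯ ⊗ e` (`b` factors). -/
def productState (b : ℕ) : Matrix (Fin b → Fin 2) (Fin b → Fin 2) ℂ :=
  Matrix.of fun x y => (∏ i, qubit (x i)) * star (∏ i, qubit (y i))

end QTomo

end

open MeasureTheory ProbabilityTheory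
open scoped ComplexOrder

noncomputable section

namespace QTomo

open scoped ENNReal Matrix

/-! Every Pauli matrix `A` is a Hermitian involution, so a measurement of it has only the outcomes
±1, with probabilities q and 1 - q, where q = (1 + tr(Aρ))/2 (`successProb`). Both claims are
statements about this number.

For (a): the identity has one sure outcome and never counts. Any other Pauli matrix is traceless, so
it has both eigenvalues, and it counts exactly when 0 < q < 1. In the product state tr(B_l ρ)
factors into the Bloch coordinates of `e`, and those of σ₁, σ₂, σ₃ have modulus below 1, so all
remaining p - 1 matrices count. The mass depends on ρ only through a subset of a finite index set,
so it takes finitely many values and the supremum is attained without any compactness argument.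

For (b): given j, both kinds of regression data are affine images of one variable with law N(mq,
mq(1-q)), which can be recovered from them (the fine scale covariance has rank one). The average of
the signs is a bijective function of the binomial count, and the individual signs arise from the
count by a uniform random arrangement. None of these maps involves ρ, so both distances reduce to
comparing the normal law with the binomial law, whose inner counts are spread uniformly over unit
cells; rounding undoes the spreading. The counts 0 and m stay atoms, so that for q = 0 or q = 1 the
two laws are the same point mass.

For the other q the comparison is in Hellinger affinity (`affinityGE_normalLaw_smoothLaw`). The
inequality √(ab) ≥ b(1 + (log a - log b)/2) reduces it to a relative entropy. Stirling's formula and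
a cubic lower bound for u log u majorize that entropy by the binomial mean of a cubic in k - mq,
whose leading quadratic part cancels the Gaussian exponent. The first three central moments then
leave O(1/(κ²m)), with κ = min(c₀, 1 - c₁).

Affinity is used because it multiplies over independent observations: a loss ε per observation
becomes at most nε, hence a total variation distance of at most √(2nε), of order √(n/m). Adding
total variation distances would give only n/√m. -/

/-! ### Hellinger affinity -/

section Affinity

variable {X : Type*} [MeasurableSpace X]

/-- The measures `P` and `Q` dominate measures with densities `u ^ 2` and `v ^ 2` whose
Hellinger affinity `∫ u v` is at least `c`. -/
def AffinityGE (P Q : Measure X) (c : ℝ≥0∞) : Prop :=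
  ∃ (μ : Measure X) (_ : IsFiniteMeasure μ) (u v : X → ℝ≥0∞), Measurable u ∧ Measurable v ∧
    μ.withDensity (fun x => u x ^ 2) ≤ P ∧ μ.withDensity (fun x => v x ^ 2) ≤ Q ∧
    c ≤ ∫⁻ x, u x * v x ∂μ

lemma AffinityGE.symm {P Q : Measure X} {c : ℝ≥0∞} (h : AffinityGE P Q c) : AffinityGE Q P c := by
  obtain ⟨μ, hμ, u, v, hu, hv, hP, hQ, hc⟩ := h
  exact ⟨μ, hμ, v, u, hv, hu, hQ, hP, by simpa only [mul_comm] using hc⟩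

lemma AffinityGE.refl (P : Measure X) [IsProbabilityMeasure P] : AffinityGE P P 1 :=
  ⟨P, inferInstance, fun _ => 1, fun _ => 1, measurable_const, measurable_const,
    by simp, by simp, by simp⟩

lemma AffinityGE.mono {P Q : Measure X} {c c' : ℝ≥0∞} (h : AffinityGE P Q c) (hc : c' ≤ c) :
    AffinityGE P Q c' := by
  obtain ⟨μ, hμ, u, v, hu, hv, hP, hQ, hc⟩ := h
  exact ⟨μ, hμ, u, v, hu, hv, hP, hQ, by order⟩

lemma min_mul_max_sq (a b : ℝ≥0∞) : min a b ^ 2 + max a b ^ 2 = a ^ 2 + b ^ 2 := by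
  rcases le_total a b with h | h <;> simp [h, add_comm]

lemma lintegral_mul_sq_le {μ : Measure X} {f g : X → ℝ≥0∞} (hf : Measurable f)
    (hg : Measurable g) :
    (∫⁻ x, f x * g x ∂μ) ^ 2 ≤ (∫⁻ x, f x ^ 2 ∂μ) * ∫⁻ x, g x ^ 2 ∂μ := by
  have h := ENNReal.lintegral_mul_le_Lp_mul_Lq μ (p := 2) (q := 2) (by
    constructor <;> norm_num) hf.aemeasurable hg.aemeasurable
  simp only [Pi.mul_apply, ENNReal.rpow_ofNat] at h
  calc _ ≤ _ := pow_le_pow_left₀ (by simp) h 2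
    _ = _ := by
      rw [mul_pow, ← ENNReal.rpow_natCast, ← ENNReal.rpow_natCast (_ ^ _), ← ENNReal.rpow_mul,
        ← ENNReal.rpow_mul]
      norm_num

/-- Both integrals lie between the integral over the common part `M` and that value plus the mass
missing from `M`. -/
lemma abs_integral_sub_le_of_common_part {P Q M : Measure X} [IsProbabilityMeasure P]
    [IsProbabilityMeasure Q] (hP : M ≤ P) (hQ : M ≤ Q) {h : X → ℝ} (hm : Measurable h)
    (h0 : ∀ x, 0 ≤ h x) (h1 : ∀ x, h x ≤ 1) :
    |∫ x, h x ∂P - ∫ x, h x ∂Q| ≤ 1 - M.real Set.univ := by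
  have : IsFiniteMeasure M := isFiniteMeasure_of_le P hP
  have key : ∀ N : Measure X, IsProbabilityMeasure N → M ≤ N →
      ∃ t : ℝ, 0 ≤ t ∧ t ≤ 1 - M.real Set.univ ∧ (∫ x, h x ∂N) = t + ∫ x, h x ∂M := by
    intro N _ hR
    have hint : ∀ (ν : Measure X) [IsFiniteMeasure ν], Integrable h ν := fun ν _ =>
      Integrable.of_bound hm.aestronglyMeasurable 1 (Filter.Eventually.of_forall fun x => by
        rw [Real.norm_eq_abs, abs_of_nonneg (h0 x)]; exact h1 x)
    have : IsFiniteMeasure (N - M) := isFiniteMeasure_of_le N Measure.sub_le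
    have e : N = (N - M) + M := (Measure.sub_add_cancel_of_le hR).symm
    refine ⟨∫ x, h x ∂(N - M), integral_nonneg h0, ?_, ?_⟩
    · calc ∫ x, h x ∂(N - M) ≤ ∫ _, (1 : ℝ) ∂(N - M) :=
            integral_mono (hint _) (integrable_const _) h1
        _ = (N - M).real Set.univ := by simp
        _ = 1 - M.real Set.univ := by
            have h2 : N.real Set.univ = (N - M).real Set.univ + M.real Set.univ := by
              conv_lhs => rw [e]
              exact measureReal_add_apply
            simp at h2
            linarith
    · conv_lhs => rw [e]
      exact integral_add_measure (hint _) (hint _)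
  obtain ⟨t, ht0, ht1, ht⟩ := key P inferInstance hP
  obtain ⟨s, hs0, hs1, hs⟩ := key Q inferInstance hQ
  rw [ht, hs, abs_le]
  constructor <;> linarith

/-- The common part has density min(u, v)², of mass t say. Since uv = min · max and min² + max² = u²
+ v², Cauchy–Schwarz gives (1 - ε)² ≤ t(2 - t) = 1 - (1 - t)² when ε ≤ 1, that is 1 - t ≤ √(2ε). -/
lemma AffinityGE.abs_integral_sub_le {P Q : Measure X} [IsProbabilityMeasure P]
    [IsProbabilityMeasure Q] {ε : ℝ} (hε : 0 ≤ ε) (hA : AffinityGE P Q (ENNReal.ofReal (1 - ε)))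
    {h : X → ℝ} (hm : Measurable h) (h0 : ∀ x, 0 ≤ h x) (h1 : ∀ x, h x ≤ 1) :
    |∫ x, h x ∂P - ∫ x, h x ∂Q| ≤ Real.sqrt (2 * ε) := by
  obtain ⟨μ, _, u, v, hu, hv, hP, hQ, hc⟩ := hA
  set M : Measure X := μ.withDensity fun x => min (u x) (v x) ^ 2 with hM
  have hMP : M ≤ P := le_trans (withDensity_mono (Filter.Eventually.of_forall fun x =>
    pow_le_pow_left₀ (by simp) (min_le_left _ _) 2)) hP
  have hMQ : M ≤ Q := le_trans (withDensity_mono (Filter.Eventually.of_forall fun x =>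
    pow_le_pow_left₀ (by simp) (min_le_right _ _) 2)) hQ
  refine (abs_integral_sub_le_of_common_part hMP hMQ hm h0 h1).trans (Real.le_sqrt_of_sq_le ?_)
  have : IsFiniteMeasure M := isFiniteMeasure_of_le P hMP
  set t := M.real Set.univ with ht
  have ht0 : 0 ≤ t := measureReal_nonneg
  have hMu : M Set.univ = ENNReal.ofReal t := by rw [ht, ofReal_measureReal]
  have hMu1 : M Set.univ ≤ 1 := (hMP _).trans (by simp)
  have ht1 : t ≤ 1 := by
    rw [hMu] at hMu1
    simpa using hMu1
  have hmin : ∫⁻ x, min (u x) (v x) ^ 2 ∂μ = ENNReal.ofReal t := by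
    rw [← hMu, hM, withDensity_apply _ MeasurableSet.univ, Measure.restrict_univ]
  have hmax : ENNReal.ofReal t + ∫⁻ x, max (u x) (v x) ^ 2 ∂μ ≤ 2 := by
    rw [← hmin, ← lintegral_add_left (by fun_prop)]
    simp_rw [min_mul_max_sq]
    rw [lintegral_add_left (by fun_prop)]
    have e1 := hP Set.univ
    have e2 := hQ Set.univ
    rw [withDensity_apply _ MeasurableSet.univ, Measure.restrict_univ, measure_univ] at e1 e2
    calc _ ≤ (1 : ℝ≥0∞) + 1 := add_le_add e1 e2
      _ = 2 := by norm_num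
  have hmax' : ∫⁻ x, max (u x) (v x) ^ 2 ∂μ ≤ ENNReal.ofReal (2 - t) := by
    rw [ENNReal.ofReal_sub _ ht0]
    exact ENNReal.le_sub_of_add_le_left (by simp) (by simpa using hmax)
  have hcs : ENNReal.ofReal (1 - ε) ^ 2 ≤ ENNReal.ofReal (t * (2 - t)) := by
    calc ENNReal.ofReal (1 - ε) ^ 2 ≤ (∫⁻ x, min (u x) (v x) * max (u x) (v x) ∂μ) ^ 2 := by
          refine pow_le_pow_left₀ (by simp) (hc.trans_eq ?_) 2
          simp_rw [min_mul_max]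
      _ ≤ _ := lintegral_mul_sq_le (by fun_prop) (by fun_prop)
      _ ≤ _ := by
          rw [hmin, ENNReal.ofReal_mul ht0]
          gcongr
  rcases le_total ε 1 with hε1 | hε1
  · rw [← ENNReal.ofReal_pow (by linarith), ENNReal.ofReal_le_ofReal_iff (by nlinarith)] at hcs
    nlinarith
  -- For ε ≥ 1 the bound is trivial, because 1 - t ≤ 1.
  · nlinarith

end Affinity

/-! ### Tensorization of the affinity -/

section Pi

variable {X : Type*} [MeasurableSpace X]

lemma lintegral_pi_prod {n : ℕ} (μ : Measure X) [SigmaFinite μ] {f : Fin n → X → ℝ≥0∞}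
    (hf : ∀ i, Measurable (f i)) :
    ∫⁻ x, ∏ i, f i (x i) ∂(Measure.pi fun _ : Fin n => μ) = ∏ i, ∫⁻ x, f i x ∂μ := by
  induction n with
  | zero => simp
  | succ n ih =>
    have h := measurePreserving_piFinSuccAbove (fun _ : Fin (n + 1) => μ) 0
    rw [← (h.symm _).lintegral_comp_emb (MeasurableEquiv.measurableEmbedding _)]
    simp_rw [Fin.prod_univ_succ]
    have e : ∀ a : X × (Fin n → X), f 0 ((MeasurableEquiv.piFinSuccAbove (fun _ => X) 0).symm a 0) *
        ∏ i : Fin n, f i.succ ((MeasurableEquiv.piFinSuccAbove (fun _ => X) 0).symm a i.succ) =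
        f 0 a.1 * ∏ i : Fin n, f i.succ (a.2 i) := by
      intro a
      simp [MeasurableEquiv.piFinSuccAbove, Fin.insertNthEquiv]
    simp_rw [e]
    have hm : Measurable fun x : Fin n → X => ∏ i : Fin n, f i.succ (x i) := by fun_prop
    rw [lintegral_prod_mul (f := f 0) (g := fun x : Fin n → X => ∏ i : Fin n, f i.succ (x i))
      (hf 0).aemeasurable hm.aemeasurable, ih fun i => hf _]

/-- Argued on the outer measures that define the product, so no σ-finiteness is needed. -/
lemma pi_mono_measure {n : ℕ} {μ ν : Measure X} (h : μ ≤ ν) :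
    (Measure.pi fun _ : Fin n => μ) ≤ Measure.pi fun _ : Fin n => ν := by
  refine Measure.le_iff.2 fun s hs => ?_
  rw [Measure.pi, Measure.pi, toMeasure_apply _ _ hs, toMeasure_apply _ _ hs]
  refine (OuterMeasure.le_pi.2 fun t _ => ?_ : OuterMeasure.pi _ ≤ OuterMeasure.pi _) s
  exact (OuterMeasure.pi_pi_le _ _).trans (Finset.prod_le_prod' fun i _ => h _)

/-- Products of the root densities serve as root densities for the product measures, and by Fubini
their affinity is the product of the affinities. -/
lemma AffinityGE.pi {P Q : Measure X} [IsProbabilityMeasure P] [IsProbabilityMeasure Q]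
    {c : ℝ≥0∞} (h : AffinityGE P Q c) (n : ℕ) :
    AffinityGE (Measure.pi fun _ : Fin n => P) (Measure.pi fun _ : Fin n => Q) (c ^ n) := by
  obtain ⟨μ, _, u, v, hu, hv, hP, hQ, hc⟩ := h
  have key : ∀ {w : X → ℝ≥0∞} {R : Measure X}, Measurable w → IsProbabilityMeasure R →
      μ.withDensity (fun x => w x ^ 2) ≤ R →
      (Measure.pi fun _ : Fin n => μ).withDensity (fun x => (∏ i, w (x i)) ^ 2) ≤
        Measure.pi fun _ : Fin n => R := by
    intro w R hw _ hR
    have : IsFiniteMeasure (μ.withDensity fun x => w x ^ 2) := isFiniteMeasure_of_le R hR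
    refine le_trans (le_of_eq (Measure.pi_eq fun s hs => ?_).symm) (pi_mono_measure hR)
    rw [withDensity_apply _ (MeasurableSet.univ_pi hs), ← lintegral_indicator
      (MeasurableSet.univ_pi hs)]
    have e : ∀ x : Fin n → X, (Set.univ.pi s).indicator (fun x => (∏ i, w (x i)) ^ 2) x =
        ∏ i, (s i).indicator (fun x => w x ^ 2) (x i) := by
      intro x
      by_cases hx : x ∈ Set.univ.pi s
      · rw [Set.indicator_of_mem hx, ← Finset.prod_pow]
        exact Finset.prod_congr rfl fun i _ => by
          rw [Set.indicator_of_mem (hx i trivial)]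
      · rw [Set.indicator_of_notMem hx]
        simp only [Set.mem_univ_pi, not_forall] at hx
        obtain ⟨i, hi⟩ := hx
        exact (Finset.prod_eq_zero (Finset.mem_univ i) (Set.indicator_of_notMem hi _)).symm
    simp_rw [e]
    rw [lintegral_pi_prod μ fun i => (hw.pow_const 2).indicator (hs i)]
    exact Finset.prod_congr rfl fun i _ => by
      rw [withDensity_apply _ (hs i), lintegral_indicator (hs i)]
  refine ⟨Measure.pi fun _ => μ, inferInstance, fun x => ∏ i, u (x i), fun x => ∏ i, v (x i),
    by fun_prop, by fun_prop, key hu inferInstance hP, key hv inferInstance hQ, ?_⟩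
  simp_rw [← Finset.prod_mul_distrib]
  rw [lintegral_pi_prod μ (f := fun _ x => u x * v x) fun i => hu.mul hv]
  simpa using pow_le_pow_left₀ (by simp) hc n

lemma AffinityGE.pi_ofReal {P Q : Measure X} [IsProbabilityMeasure P] [IsProbabilityMeasure Q]
    {ε : ℝ} (h : AffinityGE P Q (ENNReal.ofReal (1 - ε))) (n : ℕ) :
    AffinityGE (Measure.pi fun _ : Fin n => P) (Measure.pi fun _ : Fin n => Q)
      (ENNReal.ofReal (1 - n * ε)) := by
  refine (h.pi n).mono ?_
  rcases le_total ε 1 with hε | hε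
  · rw [← ENNReal.ofReal_pow (by linarith)]
    refine ENNReal.ofReal_le_ofReal ?_
    -- Bernoulli's inequality (1 - ε)^n ≥ 1 - nε.
    have := one_add_mul_le_pow (a := -ε) (by linarith) n
    simpa [sub_eq_add_neg] using this
  · rcases Nat.eq_zero_or_pos n with rfl | hn
    · simp
    · have : (1 : ℝ) ≤ n := by exact_mod_cast hn
      rw [ENNReal.ofReal_of_nonpos (by nlinarith)]
      simp

end Pi

/-! ### Mixtures over the design -/

section Mixture

variable {J : Type} {S S' : J → Type} [∀ j, MeasurableSpace (S j)] [∀ j, MeasurableSpace (S' j)]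

lemma measurable_of_sigma {γ : Type*} [MeasurableSpace γ] {f : (Σ j, S j) → γ}
    (h : ∀ j, Measurable fun x : S j => f ⟨j, x⟩) : Measurable f := fun _ hs =>
  MeasurableSpace.measurableSet_iInf.2 fun j => h j hs

lemma measurable_sigma_mk (j : J) : Measurable (Sigma.mk j : S j → Σ j, S j) := fun _ hs =>
  MeasurableSpace.measurableSet_iInf.1 hs j

/-- A kernel acting on the data part of an observation `(j, s)`. -/
def sigmaKernel (K : ∀ j, Kernel (S j) (S' j)) : Kernel (Σ j, S j) (Σ j, S' j) where
  toFun x := (K x.1 x.2).map (Sigma.mk x.1)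
  measurable' := measurable_of_sigma fun j =>
    (Measure.measurable_map _ (measurable_sigma_mk j)).comp (K j).measurable

instance (K : ∀ j, Kernel (S j) (S' j)) [∀ j, IsMarkovKernel (K j)] :
    IsMarkovKernel (sigmaKernel K) :=
  ⟨fun x => Measure.isProbabilityMeasure_map (measurable_sigma_mk x.1).aemeasurable⟩

variable [Fintype J]

instance (w : PMF J) (μ : ∀ j, Measure (S j)) [∀ j, IsProbabilityMeasure (μ j)] :
    IsProbabilityMeasure (mixtureLaw w μ) := by
  constructor
  simp only [mixtureLaw, Measure.coe_finsetSum, Finset.sum_apply, Measure.smul_apply, smul_eq_mul]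
  have : ∀ j, (μ j).map (Sigma.mk j) Set.univ = 1 := fun j => by
    rw [Measure.map_apply (measurable_sigma_mk j) MeasurableSet.univ]
    simp
  simp_rw [this, mul_one]
  rw [← tsum_fintype (L := .unconditional J), w.tsum_coe]

lemma lintegral_mixtureLaw (w : PMF J) (μ : ∀ j, Measure (S j)) {f : (Σ j, S j) → ℝ≥0∞}
    (hf : Measurable f) :
    ∫⁻ x, f x ∂(mixtureLaw w μ) = ∑ j, w j * ∫⁻ x, f ⟨j, x⟩ ∂(μ j) := by
  rw [mixtureLaw, lintegral_finsetSum_measure]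
  refine Finset.sum_congr rfl fun j _ => ?_
  rw [lintegral_smul_measure, lintegral_map hf (measurable_sigma_mk j), smul_eq_mul]

lemma mixtureLaw_bind (w : PMF J) (μ : ∀ j, Measure (S j)) (K : ∀ j, Kernel (S j) (S' j)) :
    (mixtureLaw w μ).bind (sigmaKernel K) = mixtureLaw w fun j => (μ j).bind (K j) := by
  refine Measure.ext_of_lintegral _ fun f hf => ?_
  rw [Measure.lintegral_bind (Kernel.aemeasurable _) hf.aemeasurable, lintegral_mixtureLaw _ _ hf,
    lintegral_mixtureLaw _ _ hf.lintegral_kernel]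
  refine Finset.sum_congr rfl fun j _ => ?_
  rw [Measure.lintegral_bind (f := fun x => f ⟨j, x⟩) (Kernel.aemeasurable _)
    (hf.comp (measurable_sigma_mk j)).aemeasurable]
  congr 1
  exact lintegral_congr fun x => lintegral_map hf (measurable_sigma_mk j)

lemma mixtureLaw_mono (w : PMF J) {μ ν : ∀ j, Measure (S j)} (h : ∀ j, μ j ≤ ν j) :
    mixtureLaw w μ ≤ mixtureLaw w ν := by
  refine Finset.sum_le_sum fun j _ => ?_
  have := Measure.map_mono (h j) (measurable_sigma_mk j)
  exact Measure.le_iff.2 fun s _ => mul_le_mul_right (this s) _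

/-- The index is part of the observation and has the same law on both sides, so the affinity of the
mixtures is at least the design average of the conditional affinities. -/
lemma AffinityGE.mixture (w : PMF J) {P Q : ∀ j, Measure (S j)} {c : ℝ≥0∞}
    (h : ∀ j, AffinityGE (P j) (Q j) c) : AffinityGE (mixtureLaw w P) (mixtureLaw w Q) c := by
  choose μ hμ u v hu hv hP hQ hc using h
  have hU : Measurable fun x : Σ j, S j => u x.1 x.2 := measurable_of_sigma hu
  have hV : Measurable fun x : Σ j, S j => v x.1 x.2 := measurable_of_sigma hv
  have key : ∀ {f : ∀ j, S j → ℝ≥0∞} {R : ∀ j, Measure (S j)}, (∀ j, Measurable (f j)) →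
      (∀ j, (μ j).withDensity (fun x => f j x ^ 2) ≤ R j) →
      (mixtureLaw w μ).withDensity (fun x => f x.1 x.2 ^ 2) ≤ mixtureLaw w R := by
    intro f R hf hR
    refine le_trans (le_of_eq ?_) (mixtureLaw_mono w hR)
    have hF : Measurable fun x : Σ j, S j => f x.1 x.2 := measurable_of_sigma hf
    refine Measure.ext_of_lintegral _ fun g hg => ?_
    rw [lintegral_withDensity_eq_lintegral_mul _ (hF.pow_const 2) hg, lintegral_mixtureLaw _ _ hg,
      lintegral_mixtureLaw _ _ ((hF.pow_const 2).mul hg)]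
    refine Finset.sum_congr rfl fun j _ => ?_
    rw [lintegral_withDensity_eq_lintegral_mul (g := fun x => g ⟨j, x⟩) _ ((hf j).pow_const 2)
      (hg.comp (measurable_sigma_mk j))]
    rfl
  have hsf : IsFiniteMeasure (mixtureLaw w μ) := by
    constructor
    rw [← lintegral_one, lintegral_mixtureLaw (f := fun _ => 1) _ _ measurable_const]
    exact ENNReal.sum_lt_top.2 fun j _ => ENNReal.mul_lt_top (w.apply_lt_top j) (by simp)
  refine ⟨mixtureLaw w μ, hsf, _, _, hU, hV, key hu hP, key hv hQ, ?_⟩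
  rw [lintegral_mixtureLaw (f := fun x => u x.1 x.2 * v x.1 x.2) _ _ (hU.mul hV)]
  calc c = ∑ j, w j * c := by
        rw [← Finset.sum_mul, ← tsum_fintype (L := .unconditional J), w.tsum_coe, one_mul]
    _ ≤ _ := Finset.sum_le_sum fun j _ => mul_le_mul_right (hc j) _

end Mixture

/-! ### Product kernels -/

section PiKernel

variable {X Y : Type*} [MeasurableSpace X] [MeasurableSpace Y]

/-- The kernel acting independently on the coordinates. -/
def piKernel (n : ℕ) (K : Kernel X Y) [IsMarkovKernel K] : Kernel (Fin n → X) (Fin n → Y) where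
  toFun x := Measure.pi fun i => K (x i)
  measurable' := by
    refine Measurable.measure_of_isPiSystem_of_isProbabilityMeasure generateFrom_pi.symm
      isPiSystem_pi ?_
    rintro _ ⟨s, hs, rfl⟩
    simp_rw [Measure.pi_pi]
    exact Finset.measurable_prod _ fun i _ =>
      (K.measurable_coe (hs i trivial)).comp (measurable_pi_apply i)

instance (n : ℕ) (K : Kernel X Y) [IsMarkovKernel K] : IsMarkovKernel (piKernel n K) :=
  ⟨fun x => inferInstanceAs (IsProbabilityMeasure (Measure.pi fun i => K (x i)))⟩

lemma pi_bind_piKernel (n : ℕ) (P : Measure X) [IsProbabilityMeasure P] (K : Kernel X Y)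
    [IsMarkovKernel K] :
    (Measure.pi fun _ : Fin n => P).bind (piKernel n K) = Measure.pi fun _ : Fin n => P.bind K := by
  symm
  refine Measure.pi_eq fun s hs => ?_
  rw [Measure.bind_apply (MeasurableSet.univ_pi hs) (Kernel.aemeasurable _)]
  have e : ∀ x, piKernel n K x (Set.univ.pi s) = ∏ i, K (x i) (s i) := fun x => Measure.pi_pi _ _
  simp_rw [e]
  rw [lintegral_pi_prod P (f := fun i x => K x (s i)) fun i => K.measurable_coe (hs i)]
  exact Finset.prod_congr rfl fun i _ =>
    (Measure.bind_apply (hs i) (Kernel.aemeasurable _)).symm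

end PiKernel

/-! ### Bounding the deficiency -/

section Deficiency

variable {T Ω Ω' X : Type} [MeasurableSpace Ω] [MeasurableSpace Ω'] [MeasurableSpace X]

lemma integral_bind_kernel {Z Z' : Type} [MeasurableSpace Z] [MeasurableSpace Z'] (ν : Measure Z)
    [IsProbabilityMeasure ν] (κ : Kernel Z Z') {f : Z' → ℝ} (hf : Integrable f (ν.bind κ)) :
    ∫ z, f z ∂(ν.bind κ) = ∫ x, ∫ y, f y ∂(κ x) ∂ν := by
  rw [Measure.comp_eq_comp_const_apply] at hf ⊢
  rw [Kernel.integral_comp hf, Kernel.const_apply]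

/-- A procedure χ' is imitated by χ' ∘ K' ∘ K. Both risks are then integrals, over `M ρ` and `M' ρ`,
of the same [0,1]-valued function: the expected loss after applying χ' ∘ K'. -/
lemma deficiency_le_of_kernels {P : T → Measure Ω} {P' : T → Measure Ω'} {M M' : T → Measure X}
    [∀ ρ, IsProbabilityMeasure (P ρ)] [∀ ρ, IsProbabilityMeasure (M ρ)] [∀ ρ, IsProbabilityMeasure (M' ρ)]
    (K : Kernel Ω X) [IsMarkovKernel K] (K' : Kernel X Ω') [IsMarkovKernel K']
    (hK : ∀ ρ, (P ρ).bind K = M ρ) (hK' : ∀ ρ, (M' ρ).bind K' = P' ρ) {ε : ℝ}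
    (h : ∀ ρ, ∀ f : X → ℝ, Measurable f → (∀ x, 0 ≤ f x) → (∀ x, f x ≤ 1) →
      |∫ x, f x ∂(M ρ) - ∫ x, f x ∂(M' ρ)| ≤ ε) :
    deficiency P P' ≤ ENNReal.ofReal ε := by
  refine iSup_le fun A => iSup_le fun _ => iSup_le fun χ' => iSup_le fun _ => ?_
  refine iInf_le_of_le (χ' ∘ₖ K' ∘ₖ K) (iInf_le_of_le inferInstance ?_)
  refine iSup_le fun ρ => iSup_le fun L => iSup_le fun hL => ENNReal.ofReal_le_ofReal ?_
  have hL1 : ∀ a, L ρ a ≤ 1 := fun a => hL.sup_eq_one.1 ⟨(ρ, a), rfl⟩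
  have hint : ∀ (ν : Measure A) [IsFiniteMeasure ν], Integrable (L ρ) ν := fun ν _ =>
    Integrable.of_bound (hL.measurable ρ).aestronglyMeasurable 1 (Filter.Eventually.of_forall
      fun a => by rw [Real.norm_eq_abs, abs_of_nonneg (hL.nonneg ρ a)]; exact hL1 a)
  set f : X → ℝ := fun x => ∫ a, L ρ a ∂((χ' ∘ₖ K') x) with hf
  have hfm : Measurable f := by
    have : StronglyMeasurable f :=
      (hL.measurable ρ).stronglyMeasurable.integral_kernel
    exact this.measurable
  have hf0 : ∀ x, 0 ≤ f x := fun x => integral_nonneg (hL.nonneg ρ)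
  have hf1 : ∀ x, f x ≤ 1 := fun x => by
    calc f x ≤ ∫ _, (1 : ℝ) ∂((χ' ∘ₖ K') x) := integral_mono (hint _) (integrable_const _) hL1
      _ = 1 := by simp
  have hfi : ∀ (ν : Measure X) [IsFiniteMeasure ν], Integrable f ν := fun ν _ =>
    Integrable.of_bound hfm.aestronglyMeasurable 1 (Filter.Eventually.of_forall
      fun a => by rw [Real.norm_eq_abs, abs_of_nonneg (hf0 a)]; exact hf1 a)
  set g : Ω' → ℝ := fun ω => ∫ a, L ρ a ∂(χ' ω) with hg
  have hgm : Measurable g := by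
    have : StronglyMeasurable g :=
      (hL.measurable ρ).stronglyMeasurable.integral_kernel
    exact this.measurable
  have hg0 : ∀ x, 0 ≤ g x := fun x => integral_nonneg (hL.nonneg ρ)
  have hg1 : ∀ x, g x ≤ 1 := fun x => by
    calc g x ≤ ∫ _, (1 : ℝ) ∂(χ' x) := integral_mono (hint _) (integrable_const _) hL1
      _ = 1 := by simp
  have hgi : ∀ (ν : Measure Ω') [IsFiniteMeasure ν], Integrable g ν := fun ν _ =>
    Integrable.of_bound hgm.aestronglyMeasurable 1 (Filter.Eventually.of_forall
      fun a => by rw [Real.norm_eq_abs, abs_of_nonneg (hg0 a)]; exact hg1 a)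
  have e1 : risk P (χ' ∘ₖ K' ∘ₖ K) L ρ = ∫ x, f x ∂(M ρ) := by
    rw [risk, ← hK ρ, integral_bind_kernel _ _ (hfi _)]
    exact integral_congr_ae (Filter.Eventually.of_forall fun ω => Kernel.integral_comp (hint _))
  have e2 : risk P' χ' L ρ = ∫ x, f x ∂(M' ρ) := by
    rw [risk, ← hK' ρ, integral_bind_kernel _ _ (hgi _)]
    exact integral_congr_ae (Filter.Eventually.of_forall fun ω =>
      (Kernel.integral_comp (hint _)).symm)
  rw [e1, e2]
  exact h ρ f hfm hf0 hf1

/-- If `μ j` and `ν j` are linked, through Markov kernels free of the parameter, to `α j` and `β j`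
whose affinity is at least `1 - ε`, then the deficiency of the `n`-fold mixture experiments is at
most `√(2 n ε)`. -/
lemma deficiency_pi_mixture_le {J : Type} [Fintype J] (w : PMF J) {S S' U : J → Type}
    [∀ j, MeasurableSpace (S j)] [∀ j, MeasurableSpace (S' j)] [∀ j, MeasurableSpace (U j)]
    {μ : T → ∀ j, Measure (S j)} {ν : T → ∀ j, Measure (S' j)} {α β : T → ∀ j, Measure (U j)}
    [∀ ρ j, IsProbabilityMeasure (μ ρ j)] [∀ ρ j, IsProbabilityMeasure (α ρ j)]
    [∀ ρ j, IsProbabilityMeasure (β ρ j)]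
    (K : ∀ j, Kernel (S j) (U j)) [∀ j, IsMarkovKernel (K j)]
    (K' : ∀ j, Kernel (U j) (S' j)) [∀ j, IsMarkovKernel (K' j)]
    (hK : ∀ ρ j, (μ ρ j).bind (K j) = α ρ j) (hK' : ∀ ρ j, (β ρ j).bind (K' j) = ν ρ j)
    {ε : ℝ} (hε : 0 ≤ ε) (h : ∀ ρ j, AffinityGE (α ρ j) (β ρ j) (ENNReal.ofReal (1 - ε))) (n : ℕ) :
    deficiency (fun ρ => Measure.pi fun _ : Fin n => mixtureLaw w (μ ρ))
      (fun ρ => Measure.pi fun _ : Fin n => mixtureLaw w (ν ρ)) ≤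
      ENNReal.ofReal (Real.sqrt (2 * (n * ε))) := by
  refine deficiency_le_of_kernels (M := fun ρ => Measure.pi fun _ : Fin n => mixtureLaw w (α ρ))
    (M' := fun ρ => Measure.pi fun _ : Fin n => mixtureLaw w (β ρ))
    (piKernel n (sigmaKernel K)) (piKernel n (sigmaKernel K')) (fun ρ => ?_) (fun ρ => ?_) ?_
  · rw [pi_bind_piKernel, mixtureLaw_bind]
    simp_rw [hK]
  · rw [pi_bind_piKernel, mixtureLaw_bind]
    simp_rw [hK']
  · intro ρ f hf h0 h1
    exact ((AffinityGE.mixture w (h ρ)).pi_ofReal n).abs_integral_sub_le (by positivity) hf h0 h1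

end Deficiency

/-! ### Binomial weights and their moments -/

/-- The binomial probability of `k` successes in `m` trials. -/
def binomWeight (m : ℕ) (q : ℝ) (k : ℕ) : ℝ := (m.choose k : ℝ) * q ^ k * (1 - q) ^ (m - k)

/-- The expectation of `f` under the binomial distribution. -/
def binomMean (m : ℕ) (q : ℝ) (f : ℕ → ℝ) : ℝ :=
  ∑ k ∈ Finset.range (m + 1), binomWeight m q k * f k

lemma binomWeight_nonneg {m : ℕ} {q : ℝ} (h0 : 0 ≤ q) (h1 : q ≤ 1) (k : ℕ) :
    0 ≤ binomWeight m q k := by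
  have : 0 ≤ 1 - q := by linarith
  unfold binomWeight
  positivity

lemma binomWeight_pos {m : ℕ} {q : ℝ} (h0 : 0 < q) (h1 : q < 1) {k : ℕ} (hk : k ≤ m) :
    0 < binomWeight m q k := by
  have h2 : 0 < 1 - q := by linarith
  have : 0 < m.choose k := Nat.choose_pos hk
  unfold binomWeight
  positivity

/-- Conditioning on one of the trials, that is Pascal's rule. -/
lemma binomMean_succ (m : ℕ) (q : ℝ) (f : ℕ → ℝ) :
    binomMean (m + 1) q f = q * binomMean m q (fun k => f (k + 1)) + (1 - q) * binomMean m q f := by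
  have h := Finset.sum_antidiagonal_choose_succ_mul (R := ℝ)
    (fun i j => q ^ i * (1 - q) ^ j * f i) m
  rw [Finset.Nat.sum_antidiagonal_eq_sum_range_succ_mk,
    Finset.Nat.sum_antidiagonal_eq_sum_range_succ_mk,
    Finset.Nat.sum_antidiagonal_eq_sum_range_succ_mk] at h
  simp only [binomMean, binomWeight, Finset.mul_sum]
  calc _ = _ := Finset.sum_congr rfl fun k _ => by ring
    _ = _ := h
    _ = _ := by
      rw [add_comm]
      congr 1
      · refine Finset.sum_congr rfl fun k hk => ?_
        rw [Nat.choose_symm (Finset.mem_range_succ_iff.1 hk)]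
        ring
      · exact Finset.sum_congr rfl fun k _ => by ring

lemma binomMean_add (m : ℕ) (q : ℝ) (f g : ℕ → ℝ) :
    binomMean m q (fun k => f k + g k) = binomMean m q f + binomMean m q g := by
  simp only [binomMean, mul_add, Finset.sum_add_distrib]

lemma binomMean_const_mul (m : ℕ) (q c : ℝ) (f : ℕ → ℝ) :
    binomMean m q (fun k => c * f k) = c * binomMean m q f := by
  simp only [binomMean, Finset.mul_sum]
  exact Finset.sum_congr rfl fun k _ => by ring

lemma binomMean_one (m : ℕ) (q : ℝ) : binomMean m q (fun _ => 1) = 1 := by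
  induction m with
  | zero => simp [binomMean, binomWeight]
  | succ m ih => rw [binomMean_succ, ih]; ring

/-- The first three central moments are 0, mq(1-q) and mq(1-q)(1-2q). Cubics are closed under the
shift by one trial, so the induction runs over all coefficients at once. -/
lemma binomMean_cubic (m : ℕ) (q a b c e : ℝ) (g : ℕ → ℝ)
    (hg : ∀ k, g k = a + b * (k - m * q) + c * (k - m * q) ^ 2 + e * (k - m * q) ^ 3) :
    binomMean m q g = a + c * (m * q * (1 - q)) + e * (m * q * (1 - q) * (1 - 2 * q)) := by
  obtain rfl : g = _ := funext hg
  clear hg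
  induction m generalizing a b c e with
  | zero => simp [binomMean, binomWeight]
  | succ m ih =>
    rw [binomMean_succ]
    have e1 := ih (a + b * (1 - q) + c * (1 - q) ^ 2 + e * (1 - q) ^ 3)
      (b + 2 * c * (1 - q) + 3 * e * (1 - q) ^ 2) (c + 3 * e * (1 - q)) e
    have e2 := ih (a + b * (- q) + c * q ^ 2 - e * q ^ 3)
      (b - 2 * c * q + 3 * e * q ^ 2) (c - 3 * e * q) e
    have f1 : (fun k : ℕ => a + b * (((k + 1 : ℕ) : ℝ) - ((m + 1 : ℕ) : ℝ) * q) +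
        c * (((k + 1 : ℕ) : ℝ) - ((m + 1 : ℕ) : ℝ) * q) ^ 2 +
        e * (((k + 1 : ℕ) : ℝ) - ((m + 1 : ℕ) : ℝ) * q) ^ 3) = fun k : ℕ =>
        a + b * (1 - q) + c * (1 - q) ^ 2 + e * (1 - q) ^ 3 +
          (b + 2 * c * (1 - q) + 3 * e * (1 - q) ^ 2) * (k - m * q) +
          (c + 3 * e * (1 - q)) * (k - m * q) ^ 2 + e * (k - m * q) ^ 3 :=
      funext fun k => by push_cast; ring
    have f2 : (fun k : ℕ => a + b * ((k : ℝ) - ((m + 1 : ℕ) : ℝ) * q) +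
        c * ((k : ℝ) - ((m + 1 : ℕ) : ℝ) * q) ^ 2 +
        e * ((k : ℝ) - ((m + 1 : ℕ) : ℝ) * q) ^ 3) = fun k : ℕ =>
        a + b * (- q) + c * q ^ 2 - e * q ^ 3 +
          (b - 2 * c * q + 3 * e * q ^ 2) * (k - m * q) +
          (c - 3 * e * q) * (k - m * q) ^ 2 + e * (k - m * q) ^ 3 :=
      funext fun k => by push_cast; ring
    rw [f1, f2, e1, e2]
    push_cast
    ring

/-! ### Stirling bounds -/

/-- The increment bound 1/(12n(n+1)) for the logarithm of Stirling's sequence telescopes: after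
subtraction of 1/(12n) the sequence increases to log √π. -/
lemma log_factorial_le_stirling {m : ℕ} (hm : m ≠ 0) :
    Real.log m.factorial ≤ m * Real.log m - m + Real.log (2 * Real.pi * m) / 2 + 1 / (12 * m) := by
  have hmono : Monotone fun n : ℕ =>
      Real.log (Stirling.stirlingSeq (n + 1)) - 1 / (12 * ((n : ℝ) + 1)) := by
    refine monotone_nat_of_le_succ fun n => ?_
    have h := Stirling.log_stirlingSeq_sdiff_le (n + 1)
    have e : (1 : ℝ) / (12 * ((n + 1 : ℕ) : ℝ) * (((n + 1 : ℕ) : ℝ) + 1)) =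
        1 / (12 * ((n : ℝ) + 1)) - 1 / (12 * (((n + 1 : ℕ) : ℝ) + 1)) := by
      push_cast
      field_simp
      ring
    rw [e] at h
    linarith
  have hlim : Filter.Tendsto (fun n : ℕ =>
      Real.log (Stirling.stirlingSeq (n + 1)) - 1 / (12 * ((n : ℝ) + 1))) Filter.atTop
      (nhds (Real.log (Real.sqrt Real.pi) - 0)) := by
    refine Filter.Tendsto.sub ?_ ?_
    · exact ((Filter.tendsto_add_atTop_iff_nat 1).2
        Stirling.tendsto_stirlingSeq_sqrt_pi).log (by positivity)
    · have h := (tendsto_one_div_add_atTop_nhds_zero_nat (𝕜 := ℝ)).const_mul (1 / 12)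
      rw [mul_zero] at h
      refine h.congr fun n => ?_
      field_simp
  obtain ⟨n, rfl⟩ := Nat.exists_eq_succ_of_ne_zero hm
  have h := hmono.ge_of_tendsto hlim n
  simp only [Nat.succ_eq_add_one]
  rw [Stirling.log_stirlingSeq_formula, Real.log_sqrt (by positivity), sub_zero,
    Real.log_div (by positivity) (by positivity), Real.log_exp,
    Real.log_mul (by positivity) (by positivity)] at h
  rw [Real.log_mul (by positivity) (by positivity), Real.log_mul (by positivity) (by positivity)]
  push_cast at h ⊢
  linarith

/-- Stirling's bound is taken at k + 1 and divided by k + 1, so that it also covers k = 0. -/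
lemma le_log_factorial_succ (k : ℕ) :
    ((k : ℝ) + 1) * Real.log (k + 1) - (k + 1) - Real.log (k + 1) / 2 + Real.log (2 * Real.pi) / 2
      ≤ Real.log k.factorial := by
  have h := Stirling.le_log_factorial_stirling (n := k + 1) (by omega)
  have hk : (0 : ℝ) < k + 1 := by positivity
  rw [Nat.factorial_succ] at h
  push_cast at h
  rw [Real.log_mul (x := (k : ℝ) + 1) (by positivity) (by positivity)] at h
  linarith

/-- This function vanishes at 1 and is the derivative of the difference of the two sides in
`cubic_le_mul_log`; its own derivative is (u-1)²/u. -/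
lemma monotoneOn_log_sub_quadratic :
    MonotoneOn (fun u : ℝ => Real.log u - (u - 1) + (u - 1) ^ 2 / 2) (Set.Ioi 0) := by
  have hd : ∀ u : ℝ, 0 < u → HasDerivAt (fun u : ℝ => Real.log u - (u - 1) + (u - 1) ^ 2 / 2)
      ((u - 1) ^ 2 / u) u := fun u hu => by
    have h := ((Real.hasDerivAt_log hu.ne').sub ((hasDerivAt_id u).sub_const 1)).add
      ((((hasDerivAt_id u).sub_const 1).pow 2).div_const 2)
    convert! h using 1
    simp
    field_simp
    ring
  refine monotoneOn_of_deriv_nonneg (convex_Ioi 0)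
    (fun u hu => (hd u hu).continuousAt.continuousWithinAt) (fun u hu => ?_) fun u hu => ?_
  · rw [interior_Ioi] at hu
    exact (hd u hu).differentiableAt.differentiableWithinAt
  · rw [interior_Ioi] at hu
    have hu : 0 < u := hu
    rw [(hd u hu).deriv]
    positivity

lemma cubic_le_mul_log {u : ℝ} (hu : 0 < u) :
    (u - 1) + (u - 1) ^ 2 / 2 - (u - 1) ^ 3 / 6 ≤ u * Real.log u := by
  set g : ℝ → ℝ := fun u => u * Real.log u - ((u - 1) + (u - 1) ^ 2 / 2 - (u - 1) ^ 3 / 6) with hg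
  have hd : ∀ u : ℝ, 0 < u → HasDerivAt g (Real.log u - (u - 1) + (u - 1) ^ 2 / 2) u := by
    intro u hu
    have h0 := (hasDerivAt_id u).sub_const 1
    have h := (Real.hasDerivAt_mul_log hu.ne').sub ((h0.add ((h0.pow 2).div_const 2)).sub
      ((h0.pow 3).div_const 6))
    convert! h using 1
    simp
    ring
  have hg1 : g 1 = 0 := by simp [hg]
  suffices 0 ≤ g u by simp only [hg] at this; linarith
  rw [← hg1]
  rcases le_total u 1 with h | h
  · have : AntitoneOn g (Set.Icc u 1) := by
      refine antitoneOn_of_deriv_nonpos (convex_Icc u 1)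
        (fun x hx => (hd x (hu.trans_le hx.1)).continuousAt.continuousWithinAt) ?_ ?_ <;>
        rw [interior_Icc] <;> intro x hx
      · exact (hd x (hu.trans hx.1)).differentiableAt.differentiableWithinAt
      · rw [(hd x (hu.trans hx.1)).deriv]
        simpa using monotoneOn_log_sub_quadratic (hu.trans hx.1) (by simp : (1 : ℝ) ∈ Set.Ioi 0)
          hx.2.le
    exact this ⟨le_rfl, h⟩ ⟨h, le_rfl⟩ h
  · have : MonotoneOn g (Set.Icc 1 u) := by
      refine monotoneOn_of_deriv_nonneg (convex_Icc 1 u)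
        (fun x hx => (hd x (one_pos.trans_le hx.1)).continuousAt.continuousWithinAt) ?_ ?_ <;>
        rw [interior_Icc] <;> intro x hx
      · exact (hd x (one_pos.trans hx.1)).differentiableAt.differentiableWithinAt
      · rw [(hd x (one_pos.trans hx.1)).deriv]
        simpa using monotoneOn_log_sub_quadratic (by simp : (1 : ℝ) ∈ Set.Ioi 0)
          (one_pos.trans hx.1) hx.1.le
    exact this ⟨le_rfl, h⟩ ⟨h, le_rfl⟩ h

/-- The upper bound, up to the additive term `-(1/2) log (2 π m q (1 - q))`, for the logarithm of
the binomial probability of `m q + D`. -/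
def logWeightBound (m : ℕ) (q D : ℝ) : ℝ :=
  1 / (12 * m) - 1 / (2 * m * q) * ((D + 1) ^ 2 - (D + 1)) +
    (D + 1) ^ 3 / (6 * (m * q) ^ 2) - 1 / (2 * m * (1 - q)) * ((1 - D) ^ 2 - (1 - D)) +
    (1 - D) ^ 3 / (6 * (m * (1 - q)) ^ 2)

/-- Stirling from above for m! and from below for k! and (m-k)!. With u = (k+1)/(mq) and w =
(m-k+1)/(m(1-q)), the main terms are -mq · u log u and -m(1-q) · w log w, bounded by
`cubic_le_mul_log`; the remaining half logarithms are bounded by log u ≤ u - 1. -/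
lemma log_binomWeight_le {m : ℕ} (hm : 0 < m) {q : ℝ} (h0 : 0 < q) (h1 : q < 1) {k : ℕ}
    (hk : k ≤ m) :
    Real.log (binomWeight m q k) ≤ - Real.log (2 * Real.pi * (m * q * (1 - q))) / 2 +
      logWeightBound m q (k - m * q) := by
  have h2 : 0 < 1 - q := by linarith
  have hmr : (0 : ℝ) < m := by exact_mod_cast hm
  set l := m - k with hl
  have hlr : (l : ℝ) = m - k := by rw [hl, Nat.cast_sub hk]
  have hkr : (0 : ℝ) < k + 1 := by positivity
  have hlp : (0 : ℝ) < l + 1 := by positivity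
  set u : ℝ := (k + 1) / (m * q) with hu
  set w : ℝ := (l + 1) / (m * (1 - q)) with hw
  have hup : 0 < u := by positivity
  have hwp : 0 < w := by positivity
  have lu : Real.log (k + 1) = Real.log u + Real.log m + Real.log q := by
    rw [hu, Real.log_div (by positivity) (by positivity), Real.log_mul (by positivity) (by positivity)]
    ring
  have lw : Real.log (l + 1) = Real.log w + Real.log m + Real.log (1 - q) := by
    rw [hw, Real.log_div (by positivity) (by positivity), Real.log_mul (by positivity) (by positivity)]
    ring
  have hb : Real.log (binomWeight m q k) = Real.log m.factorial - Real.log k.factorial -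
      Real.log l.factorial + k * Real.log q + l * Real.log (1 - q) := by
    have : 0 < m.choose k := Nat.choose_pos hk
    rw [binomWeight, Real.log_mul (by positivity) (by positivity),
      Real.log_mul (by positivity) (by positivity), Real.log_pow, Real.log_pow,
      Nat.cast_choose ℝ hk, Real.log_div (by positivity) (by positivity),
      Real.log_mul (by positivity) (by positivity)]
    ring
  have s1 := log_factorial_le_stirling hm.ne'
  have s2 := le_log_factorial_succ k
  have s3 := le_log_factorial_succ l
  have c1 := mul_le_mul_of_nonneg_left (cubic_le_mul_log hup) (by positivity : 0 ≤ (m : ℝ) * q)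
  have c2 := mul_le_mul_of_nonneg_left (cubic_le_mul_log hwp) (by positivity : 0 ≤ (m : ℝ) * (1 - q))
  have d1 := Real.log_le_sub_one_of_pos hup
  have d2 := Real.log_le_sub_one_of_pos hwp
  have eu : (k : ℝ) + 1 = m * q * u := by rw [hu]; field_simp
  have ew : (l : ℝ) + 1 = m * (1 - q) * w := by rw [hw]; field_simp
  have eG : logWeightBound m q (k - m * q) = 2 + 1 / (12 * m) + (u - 1) / 2 + (w - 1) / 2 -
      m * q * ((u - 1) + (u - 1) ^ 2 / 2 - (u - 1) ^ 3 / 6) -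
      m * (1 - q) * ((w - 1) + (w - 1) ^ 2 / 2 - (w - 1) ^ 3 / 6) := by
    -- The two shifts by one add up to the constant 2 in `e3`, since (k+1) + (l+1) = m + 2.
    have e1 : (k : ℝ) - m * q + 1 = m * q * (u - 1) := by linarith
    have e2 : 1 - ((k : ℝ) - m * q) = m * (1 - q) * (w - 1) := by linarith
    have e3 : m * q * (u - 1) + m * (1 - q) * (w - 1) = 2 := by linarith
    rw [logWeightBound, e1, e2]
    field_simp
    linear_combination 144 * (m : ℝ) * e3
  rw [hb, eG]
  rw [lu] at s2
  rw [lw] at s3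
  have e3 : Real.log (2 * Real.pi * (m * q * (1 - q))) =
      Real.log (2 * Real.pi) + Real.log m + Real.log q + Real.log (1 - q) := by
    rw [Real.log_mul (x := 2 * Real.pi) (by positivity) (by positivity),
      Real.log_mul (x := m * q) (by positivity) (by positivity),
      Real.log_mul (x := (m : ℝ)) (by positivity) (by positivity)]
    ring
  have e4 : Real.log (2 * Real.pi * m) = Real.log (2 * Real.pi) + Real.log m := by
    rw [Real.log_mul (by positivity) (by positivity)]
  rw [e3]
  rw [e4] at s1
  have f1 : ((k : ℝ) + 1) * (Real.log u + Real.log m + Real.log q) =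
      m * q * (u * Real.log u) + (k + 1) * (Real.log m + Real.log q) := by rw [eu]; ring
  have f2 : ((l : ℝ) + 1) * (Real.log w + Real.log m + Real.log (1 - q)) =
      m * (1 - q) * (w * Real.log w) + (l + 1) * (Real.log m + Real.log (1 - q)) := by rw [ew]; ring
  rw [f1] at s2
  rw [f2] at s3
  rw [hlr] at s3 ⊢
  linarith

lemma binomMean_logWeightBound_le {m : ℕ} (hm : 0 < m) {q κ : ℝ} (hκ : 0 < κ) (h0 : κ ≤ q)
    (h1 : κ ≤ 1 - q) :
    binomMean m q (fun k => logWeightBound m q (k - m * q) +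
      ((k - m * q) ^ 2 + 1 / 12) / (2 * (m * q * (1 - q)))) ≤ 1 / (κ ^ 2 * m) := by
  have hq : 0 < q := by linarith
  have hq' : 0 < 1 - q := by linarith
  have hmr : (1 : ℝ) ≤ m := by exact_mod_cast hm
  set s : ℝ := m * q * (1 - q) with hs
  have hs0 : 0 < s := by positivity
  have hs1 : s ≤ m / 4 := by
    rw [hs, mul_assoc]
    nlinarith [sq_nonneg (2 * q - 1)]
  have hs2 : κ ^ 2 * m ≤ s := by
    have : κ * κ ≤ q * (1 - q) := mul_le_mul h0 h1 hκ.le hq.le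
    rw [hs]
    nlinarith
  -- Coefficients of the expansion in D = k - mq. The terms -D²/(2mq) - D²/(2m(1-q)) cancel D²/(2s),
  -- as 1/(mq) + 1/(m(1-q)) = 1/s. The remaining coefficients of D² and D³ are O(1/m²) and meet
  -- moments of order m.
  rw [binomMean_cubic m q
    (1 / (12 * m) + 1 / (24 * s) + 1 / (6 * (m * q) ^ 2) + 1 / (6 * (m * (1 - q)) ^ 2))
    (- 1 / (2 * m * q) + 1 / (2 * m * (1 - q)) + 3 / (6 * (m * q) ^ 2) -
      3 / (6 * (m * (1 - q)) ^ 2))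
    (3 / (6 * (m * q) ^ 2) + 3 / (6 * (m * (1 - q)) ^ 2))
    (1 / (6 * (m * q) ^ 2) - 1 / (6 * (m * (1 - q)) ^ 2)) _ fun k => by
      rw [logWeightBound, hs]
      field_simp
      ring]
  rw [← hs]
  have hY : 0 < κ ^ 2 * m := by positivity
  have hκ2 : κ ≤ 1 / 2 := by linarith
  have b1 : 1 / (12 * (m : ℝ)) ≤ 1 / 12 * (1 / (κ ^ 2 * m)) := by
    rw [← one_div_mul_one_div]
    gcongr
    nlinarith
  have b2 : 1 / (24 * s) ≤ 1 / 24 * (1 / (κ ^ 2 * m)) := by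
    rw [← one_div_mul_one_div]
    gcongr
  have key : ∀ t σ : ℝ, κ ≤ t → |σ| ≤ 1 →
      (1 + 3 * s + σ * s) / (6 * (m * t) ^ 2) ≤ 1 / 3 * (1 / (κ ^ 2 * m)) := by
    intro t σ ht hσ
    have h3 : 1 + 3 * s + σ * s ≤ 2 * m := by nlinarith [(abs_le.1 hσ).2]
    calc (1 + 3 * s + σ * s) / (6 * (m * t) ^ 2) ≤ (2 * m) / (6 * (m * κ) ^ 2) := by
          gcongr
      _ = 1 / 3 * (1 / (κ ^ 2 * m)) := by field_simp; norm_num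
  have k1 := key q (1 - 2 * q) h0 (abs_le.2 ⟨by linarith, by linarith⟩)
  have k2 := key (1 - q) (-(1 - 2 * q)) h1 (abs_le.2 ⟨by linarith, by linarith⟩)
  have hpos : 0 < 1 / (κ ^ 2 * m) := by positivity
  have e : 1 / (12 * (m : ℝ)) + 1 / (24 * s) + 1 / (6 * (m * q) ^ 2) + 1 / (6 * (m * (1 - q)) ^ 2) +
      (3 / (6 * (m * q) ^ 2) + 3 / (6 * (m * (1 - q)) ^ 2)) * s +
      (1 / (6 * (m * q) ^ 2) - 1 / (6 * (m * (1 - q)) ^ 2)) * (s * (1 - 2 * q)) =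
      1 / (12 * (m : ℝ)) + 1 / (24 * s) + (1 + 3 * s + (1 - 2 * q) * s) / (6 * (m * q) ^ 2) +
      (1 + 3 * s + -(1 - 2 * q) * s) / (6 * (m * (1 - q)) ^ 2) := by ring
  rw [e]
  linarith

/-! ### Counts and smoothed counts -/

/-- The binomial law of the number of successes. -/
def countLaw (m : ℕ) (q : ℝ) : Measure ℕ :=
  ∑ k ∈ Finset.range (m + 1), ENNReal.ofReal (binomWeight m q k) • Measure.dirac k

/-- The unit interval around `k`. -/
def cell (k : ℕ) : Set ℝ := Set.Ico ((k : ℝ) - 1 / 2) (k + 1 / 2)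

lemma measurableSet_cell (k : ℕ) : MeasurableSet (cell k) := measurableSet_Ico

lemma volume_cell (k : ℕ) : volume (cell k) = 1 := by
  rw [cell, Real.volume_Ico]
  norm_num

/-- Spread a count uniformly over its cell, except for the extreme counts `0` and `m`. -/
def smoothKernel (m : ℕ) : Kernel ℕ ℝ where
  toFun k := if k = 0 ∨ k = m then Measure.dirac (k : ℝ) else volume.restrict (cell k)
  measurable' := measurable_from_nat

lemma smoothKernel_apply (m k : ℕ) : smoothKernel m k =
    if k = 0 ∨ k = m then Measure.dirac (k : ℝ) else volume.restrict (cell k) := rfl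

instance (m : ℕ) : IsMarkovKernel (smoothKernel m) := ⟨fun k => by
  rw [smoothKernel_apply]
  split_ifs
  · infer_instance
  · exact ⟨by rw [Measure.restrict_apply_univ, volume_cell]⟩⟩

/-- The law of the smoothed number of successes. -/
def smoothLaw (m : ℕ) (q : ℝ) : Measure ℝ := (countLaw m q).bind (smoothKernel m)

/-- The count nearest to a real number. -/
def nearestCount (x : ℝ) : ℕ := ⌊x + 1 / 2⌋₊

lemma measurable_nearestCount : Measurable nearestCount :=
  Nat.measurable_floor.comp (measurable_id.add_const _)

lemma nearestCount_of_mem_cell {k : ℕ} {x : ℝ} (hx : x ∈ cell k) : nearestCount x = k := by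
  rcases Nat.eq_zero_or_pos k with rfl | hk
  · exact Nat.floor_eq_zero.2 (by have := hx.2; push_cast at this; linarith)
  · exact (Nat.floor_eq_iff' hk.ne').2 ⟨by linarith [hx.1], by linarith [hx.2]⟩

lemma natCast_mem_cell (k : ℕ) : (k : ℝ) ∈ cell k := ⟨by linarith, by linarith⟩

lemma nearestCount_natCast (k : ℕ) : nearestCount k = k :=
  nearestCount_of_mem_cell (natCast_mem_cell k)

lemma lintegral_countLaw (m : ℕ) (q : ℝ) (f : ℕ → ℝ≥0∞) :
    ∫⁻ k, f k ∂(countLaw m q) =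
      ∑ k ∈ Finset.range (m + 1), ENNReal.ofReal (binomWeight m q k) * f k := by
  simp [countLaw, lintegral_finsetSum_measure]

lemma isProbabilityMeasure_countLaw (m : ℕ) {q : ℝ} (h0 : 0 ≤ q) (h1 : q ≤ 1) :
    IsProbabilityMeasure (countLaw m q) := by
  constructor
  rw [← lintegral_one, lintegral_countLaw]
  simp_rw [mul_one]
  rw [← ENNReal.ofReal_sum_of_nonneg fun k _ => binomWeight_nonneg h0 h1 k]
  have := binomMean_one m q
  simp only [binomMean, mul_one] at this
  rw [this, ENNReal.ofReal_one]

lemma isProbabilityMeasure_smoothLaw (m : ℕ) {q : ℝ} (h0 : 0 ≤ q) (h1 : q ≤ 1) :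
    IsProbabilityMeasure (smoothLaw m q) := by
  have := isProbabilityMeasure_countLaw m h0 h1
  unfold smoothLaw
  infer_instance

lemma smoothKernel_map_nearestCount (m k : ℕ) :
    (smoothKernel m k).map nearestCount = Measure.dirac k := by
  rw [smoothKernel_apply]
  split_ifs
  · rw [Measure.map_dirac' measurable_nearestCount, nearestCount_natCast]
  · have : (volume.restrict (cell k)).map nearestCount =
        (volume.restrict (cell k)).map fun _ => k :=
      Measure.map_congr ((ae_restrict_iff' (measurableSet_cell k)).2
        (Filter.Eventually.of_forall fun x hx => nearestCount_of_mem_cell hx))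
    rw [this, Measure.map_const, Measure.restrict_apply_univ, volume_cell, one_smul]

/-- Smoothing loses no information: rounding recovers the count. -/
lemma smoothLaw_map_nearestCount (m : ℕ) (q : ℝ) :
    (smoothLaw m q).map nearestCount = countLaw m q := by
  refine Measure.ext_of_lintegral _ fun f hf => ?_
  rw [lintegral_map hf measurable_nearestCount, smoothLaw,
    Measure.lintegral_bind (f := fun x => f (nearestCount x)) (Kernel.aemeasurable _)
      (hf.comp measurable_nearestCount).aemeasurable]
  refine lintegral_congr fun k => ?_
  rw [← lintegral_map hf measurable_nearestCount, smoothKernel_map_nearestCount, lintegral_dirac]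

/-! ### Affinity of the smoothed binomial and the normal law -/

/-- The normal approximation of the binomial law. -/
def normalLaw (m : ℕ) (q : ℝ) : Measure ℝ := gaussianReal (m * q) (m * q * (1 - q)).toNNReal

instance (m : ℕ) (q : ℝ) : IsProbabilityMeasure (normalLaw m q) := by
  unfold normalLaw
  infer_instance

/-- Write √a √b = b exp((log a - log b)/2) and use exp x ≥ 1 + x. Integrated over densities, this
bounds the affinity below by one minus half the relative entropy. -/
lemma mul_le_sqrt_mul_sqrt {a b : ℝ} (ha : 0 < a) (hb : 0 < b) :
    b * (1 + (Real.log a - Real.log b) / 2) ≤ Real.sqrt a * Real.sqrt b := by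
  have h : Real.sqrt a * Real.sqrt b = b * Real.exp ((Real.log a - Real.log b) / 2) := by
    rw [Real.sqrt_eq_rpow, Real.sqrt_eq_rpow, Real.rpow_def_of_pos ha, Real.rpow_def_of_pos hb]
    conv_rhs => rw [← Real.exp_log hb]
    rw [← Real.exp_add, Real.log_exp, ← Real.exp_add]
    congr 1
    ring
  rw [h]
  exact mul_le_mul_of_nonneg_left (by
    have := Real.add_one_le_exp ((Real.log a - Real.log b) / 2)
    linarith) hb.le

/-- The upper bound for the relative entropy contributed by the cell of `k`. -/
def cellEntropyBound (m : ℕ) (q : ℝ) (k : ℕ) : ℝ :=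
  logWeightBound m q (k - m * q) + ((k - m * q) ^ 2 + 1 / 12) / (2 * (m * q * (1 - q)))

lemma log_gaussianPDFReal (μ : ℝ) {v : NNReal} (hv : v ≠ 0) (x : ℝ) :
    Real.log (gaussianPDFReal μ v x) =
      - Real.log (2 * Real.pi * v) / 2 - (x - μ) ^ 2 / (2 * v) := by
  have hv' : (0 : ℝ) < v := by positivity
  rw [gaussianPDFReal, Real.log_mul (by positivity) (by positivity), Real.log_exp, Real.log_inv,
    Real.log_sqrt (by positivity)]
  ring

/-- The 1/12 is the variance of the uniform law on a unit interval. -/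
lemma integral_cell_quadratic (k : ℕ) (A B M : ℝ) :
    ∫ x in cell k, (A - B * (x - M) ^ 2) = A - B * (((k : ℝ) - M) ^ 2 + 1 / 12) := by
  rw [cell, integral_Ico_eq_integral_Ioc, ← intervalIntegral.integral_of_le (by linarith),
    intervalIntegral.integral_comp_sub_right (fun x => A - B * x ^ 2) M,
    intervalIntegral.integral_sub (by simp) (by
      exact Continuous.intervalIntegrable (by fun_prop) _ _),
    intervalIntegral.integral_const_mul, integral_pow, intervalIntegral.integral_const]
  simp
  ring

lemma le_lintegral_cell {m : ℕ} (hm : 0 < m) {q : ℝ} (h0 : 0 < q) (h1 : q < 1) {k : ℕ}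
    (hk : k ≤ m) :
    ENNReal.ofReal (binomWeight m q k * (1 - cellEntropyBound m q k / 2)) ≤
      ∫⁻ x in cell k, ENNReal.ofReal (Real.sqrt (gaussianPDFReal (m * q)
        (m * q * (1 - q)).toNNReal x)) * ENNReal.ofReal (Real.sqrt (binomWeight m q k)) := by
  have hmr : (0 : ℝ) < m := by exact_mod_cast hm
  have h2 : 0 < 1 - q := by linarith
  have hs : 0 < m * q * (1 - q) := by positivity
  set v : NNReal := (m * q * (1 - q)).toNNReal with hv
  have hvr : (v : ℝ) = m * q * (1 - q) := Real.coe_toNNReal _ hs.le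
  have hv0 : v ≠ 0 := (Real.toNNReal_pos.2 hs).ne'
  set b := binomWeight m q k with hb
  have hbp : 0 < b := binomWeight_pos h0 h1 hk
  set G := logWeightBound m q (k - m * q) with hG
  set s := m * q * (1 - q) with hs'
  have hfin : IsFiniteMeasure (volume.restrict (cell k)) :=
    ⟨by rw [Measure.restrict_apply_univ, volume_cell]; simp⟩
  have hcell : ∀ f : ℝ → ℝ, Continuous f → Integrable f (volume.restrict (cell k)) := fun f hf =>
    (hf.integrableOn_Icc (a := (k : ℝ) - 1 / 2) (b := k + 1 / 2)).mono_set Set.Ico_subset_Icc_self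
  have hcont : Continuous fun x => Real.sqrt (gaussianPDFReal (m * q) v x) * Real.sqrt b := by
    unfold gaussianPDFReal
    fun_prop
  simp_rw [← ENNReal.ofReal_mul (Real.sqrt_nonneg _)]
  rw [← ofReal_integral_eq_lintegral_ofReal (hcell _ hcont)
    (Filter.Eventually.of_forall fun x => by positivity)]
  refine ENNReal.ofReal_le_ofReal ?_
  have e : b * (1 - cellEntropyBound m q k / 2) =
      ∫ x in cell k, ((b * (1 - G / 2)) - (b / (4 * s)) * (x - m * q) ^ 2) := by
    rw [integral_cell_quadratic, cellEntropyBound, ← hG, ← hs']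
    field_simp
    ring
  rw [e]
  refine integral_mono (hcell _ (by fun_prop)) (hcell _ hcont) fun x => ?_
  have h3 := mul_le_sqrt_mul_sqrt (gaussianPDFReal_pos (m * q) v x hv0) hbp
  refine le_trans ?_ h3
  rw [log_gaussianPDFReal _ hv0, hvr]
  have h4 := log_binomWeight_le hm h0 h1 hk
  rw [← hb, ← hG, ← hs'] at h4
  have h5 : b * (1 - G / 2) - b / (4 * s) * (x - m * q) ^ 2 =
      b * (1 - G / 2 - (x - m * q) ^ 2 / (2 * s) / 2) := by
    field_simp
    ring
  simp only [h5]
  refine mul_le_mul_of_nonneg_left ?_ hbp.le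
  linarith

/-- Bounds what is lost by leaving out the two end counts. With a the peak of the Gaussian density,
the left side is at most √(ab); here a ≤ 1/κ, while the weight b is exponentially small in κm, hence
at most 2/(κm)². -/
lemma binomWeight_edge_le {m : ℕ} (hm : 0 < m) {q κ : ℝ} (hκ : 0 < κ) (h0 : κ ≤ q)
    (h1 : κ ≤ 1 - q) {k : ℕ} (hk : k = 0 ∨ k = m) :
    binomWeight m q k * (1 - cellEntropyBound m q k / 2) ≤ 2 / (κ ^ 2 * m) := by
  have hmr : (1 : ℝ) ≤ m := by exact_mod_cast hm
  have hkm : k ≤ m := by omega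
  have hq : 0 < q := by linarith
  have hq' : 0 < 1 - q := by linarith
  have hs : 0 < m * q * (1 - q) := by positivity
  have hpow : ∀ t : ℝ, 0 ≤ t → κ ≤ 1 - t → t ^ m ≤ 2 / (κ * m) ^ 2 := by
    intro t ht ht'
    have hx : 0 < κ * m := by positivity
    have e1 : t ≤ Real.exp (-κ) := by linarith [Real.add_one_le_exp (-κ)]
    calc t ^ m ≤ Real.exp (-κ) ^ m := pow_le_pow_left₀ ht e1 m
      _ = (Real.exp (κ * m))⁻¹ := by rw [← Real.exp_nat_mul, ← Real.exp_neg]; ring_nf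
      _ ≤ ((κ * m) ^ 2 / 2)⁻¹ := by
          gcongr
          have := Real.quadratic_le_exp_of_nonneg hx.le
          linarith
      _ = _ := by rw [inv_div]
  have hb : binomWeight m q k ≤ 2 / (κ * m) ^ 2 := by
    rcases hk with rfl | rfl
    · simpa [binomWeight] using hpow (1 - q) hq'.le (by linarith)
    · simpa [binomWeight] using hpow q hq.le h1
  have hbp : 0 < binomWeight m q k := binomWeight_pos hq (by linarith) hkm
  set b := binomWeight m q k
  set s := m * q * (1 - q) with hs'
  have hsκ : κ ^ 2 ≤ 2 * Real.pi * s := by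
    have e1 : κ * κ ≤ q * (1 - q) := mul_le_mul h0 h1 hκ.le hq.le
    have e2 : q * (1 - q) ≤ s := by
      rw [hs', mul_assoc]
      exact le_mul_of_one_le_left (by positivity) hmr
    have e3 : s ≤ 2 * Real.pi * s :=
      le_mul_of_one_le_left hs.le (by linarith [Real.pi_gt_three])
    nlinarith
  set a := (Real.sqrt (2 * Real.pi * s))⁻¹ with ha
  have hap : 0 < a := by positivity
  have haκ : a ≤ 1 / κ := by
    rw [ha, one_div]
    gcongr
    exact Real.le_sqrt_of_sq_le hsκ
  have hla : Real.log a = - Real.log (2 * Real.pi * s) / 2 := by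
    rw [ha, Real.log_inv, Real.log_sqrt (by positivity)]
    ring
  have h4 := log_binomWeight_le hm hq (by linarith) hkm
  have h5 : 0 ≤ (((k : ℝ) - m * q) ^ 2 + 1 / 12) / (2 * s) := by positivity
  calc b * (1 - cellEntropyBound m q k / 2) ≤ b * (1 + (Real.log a - Real.log b) / 2) := by
        refine mul_le_mul_of_nonneg_left ?_ hbp.le
        rw [hla, cellEntropyBound]
        linarith
    _ ≤ Real.sqrt a * Real.sqrt b := mul_le_sqrt_mul_sqrt hap hbp
    _ = Real.sqrt (a * b) := (Real.sqrt_mul hap.le _).symm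
    _ ≤ Real.sqrt ((2 / (κ ^ 2 * m)) ^ 2) := by
        refine Real.sqrt_le_sqrt ?_
        calc a * b ≤ 1 / κ * (2 / (κ * m) ^ 2) := mul_le_mul haκ hb hbp.le (by positivity)
          _ = κ / 2 * (2 / (κ ^ 2 * m)) ^ 2 := by field_simp
          _ ≤ _ := mul_le_of_le_one_left (by positivity) (by linarith)
    _ = _ := Real.sqrt_sq (by positivity)

/-- In units of 1/(κ²m), half the entropy bound costs 1/2 and each end count costs 2; 5 is a
rounded-up total. -/
lemma one_sub_le_sum_inner_cells {m : ℕ} (hm : 0 < m) {q κ : ℝ} (hκ : 0 < κ) (h0 : κ ≤ q)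
    (h1 : κ ≤ 1 - q) :
    1 - 5 / (κ ^ 2 * m) ≤
      ∑ k ∈ Finset.Ioo 0 m, binomWeight m q k * (1 - cellEntropyBound m q k / 2) := by
  have hmr : (0 : ℝ) < m := by exact_mod_cast hm
  have h2 := binomMean_logWeightBound_le hm hκ h0 h1
  have h3 : ∑ k ∈ Finset.range (m + 1), binomWeight m q k * (1 - cellEntropyBound m q k / 2) =
      1 - binomMean m q (cellEntropyBound m q) / 2 := by
    have h := binomMean_add m q (fun _ => 1) (fun k => -1 / 2 * cellEntropyBound m q k)
    rw [binomMean_one, binomMean_const_mul] at h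
    calc _ = binomMean m q (fun k => 1 + -1 / 2 * cellEntropyBound m q k) :=
          Finset.sum_congr rfl fun k _ => by ring
      _ = _ := by rw [h]; ring
  have h4 : Finset.range (m + 1) = insert 0 (insert m (Finset.Ioo 0 m)) := by
    ext k
    simp only [Finset.mem_range, Finset.mem_insert, Finset.mem_Ioo]
    omega
  rw [h4, Finset.sum_insert (by simp [hm.ne]), Finset.sum_insert (by simp)] at h3
  have e0 := binomWeight_edge_le hm hκ h0 h1 (Or.inl rfl : (0 = 0 ∨ 0 = m))
  have e1 := binomWeight_edge_le hm hκ h0 h1 (Or.inr rfl : (m = 0 ∨ m = m))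
  have h5 : binomMean m q (cellEntropyBound m q) ≤ 1 / (κ ^ 2 * m) := h2
  have h6 : (0 : ℝ) < 1 / (κ ^ 2 * m) := by positivity
  have h7 : 5 / (κ ^ 2 * m) = 5 * (1 / (κ ^ 2 * m)) := by ring
  have h8 : 2 / (κ ^ 2 * m) = 2 * (1 / (κ ^ 2 * m)) := by ring
  rw [h8] at e0 e1
  rw [h7]
  linarith

lemma sum_restrict_cell_le (t : Finset ℕ) :
    ∑ k ∈ t, volume.restrict (cell k) ≤ (volume : Measure ℝ) := by
  refine Measure.le_iff.2 fun s hs => ?_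
  simp only [Measure.coe_finsetSum, Finset.sum_apply, Measure.restrict_apply hs]
  rw [← measure_biUnion_finset]
  · exact measure_mono (Set.iUnion₂_subset fun k _ => Set.inter_subset_left)
  · intro i _ j _ hij
    refine Set.disjoint_left.2 fun x hx hx' => hij ?_
    rw [← nearestCount_of_mem_cell hx.2, nearestCount_of_mem_cell hx'.2]
  · exact fun k _ => hs.inter (measurableSet_cell k)

/-- The Hellinger distance between the smoothed binomial law and its normal approximation is of
the order `m ^ (-1/2)`. -/
lemma affinityGE_normalLaw_smoothLaw {m : ℕ} (hm : 0 < m) {q κ : ℝ} (hκ : 0 < κ) (h0 : κ ≤ q)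
    (h1 : κ ≤ 1 - q) :
    AffinityGE (normalLaw m q) (smoothLaw m q) (ENNReal.ofReal (1 - 5 / (κ ^ 2 * m))) := by
  have hmr : (0 : ℝ) < m := by exact_mod_cast hm
  have hq : 0 < q := by linarith
  have hq' : 0 < 1 - q := by linarith
  have hs : 0 < m * q * (1 - q) := by positivity
  have hv0 : (m * q * (1 - q)).toNNReal ≠ 0 := (Real.toNNReal_pos.2 hs).ne'
  set v : NNReal := (m * q * (1 - q)).toNNReal with hv
  have hb : ∀ k, 0 ≤ binomWeight m q k := binomWeight_nonneg hq.le (by linarith)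
  have hμ : IsFiniteMeasure (∑ k ∈ Finset.Ioo 0 m, volume.restrict (cell k)) := by
    constructor
    simp only [Measure.coe_finsetSum, Finset.sum_apply, Measure.restrict_apply_univ, volume_cell]
    exact ENNReal.sum_lt_top.2 fun _ _ => ENNReal.one_lt_top
  -- The base measure is Lebesgue measure on the inner cells only: at 0 and m the smoothed law has
  -- atoms. Discarding mass is allowed because `AffinityGE` asks for domination, not for exact
  -- densities.
  refine ⟨∑ k ∈ Finset.Ioo 0 m, volume.restrict (cell k), hμ,
    fun x => ENNReal.ofReal (Real.sqrt (gaussianPDFReal (m * q) v x)),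
    fun x => ENNReal.ofReal (Real.sqrt (binomWeight m q (nearestCount x))), by fun_prop, ?_,
    ?_, ?_, ?_⟩
  · exact (measurable_from_nat (f := fun k => ENNReal.ofReal (Real.sqrt (binomWeight m q k)))).comp
      measurable_nearestCount
  · rw [normalLaw, gaussianReal_of_var_ne_zero _ hv0]
    have e : (fun x => ENNReal.ofReal (Real.sqrt (gaussianPDFReal (m * q) v x)) ^ 2) =
        gaussianPDF (m * q) v := by
      funext x
      rw [← ENNReal.ofReal_pow (Real.sqrt_nonneg _), Real.sq_sqrt (gaussianPDFReal_nonneg _ _ _),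
        gaussianPDF]
    rw [e]
    refine Measure.le_iff.2 fun s hs => ?_
    rw [withDensity_apply _ hs, withDensity_apply _ hs]
    exact lintegral_mono' (Measure.restrict_mono le_rfl (sum_restrict_cell_le _)) le_rfl
  · refine Measure.le_iff.2 fun s hs => ?_
    rw [withDensity_apply _ hs, ← lintegral_indicator hs, lintegral_finsetSum_measure, smoothLaw,
      Measure.bind_apply hs (Kernel.aemeasurable _), lintegral_countLaw]
    refine (Finset.sum_le_sum fun k hk => ?_).trans
      (Finset.sum_le_sum_of_subset (s := Finset.Ioo 0 m) fun k hk => ?_)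
    · have hk' := Finset.mem_Ioo.1 hk
      rw [smoothKernel_apply, if_neg (by omega), lintegral_indicator hs,
        Measure.restrict_restrict hs, setLIntegral_congr_fun
          (g := fun _ => ENNReal.ofReal (binomWeight m q k)) (hs.inter (measurableSet_cell k))
          fun x hx => ?_, setLIntegral_const, Measure.restrict_apply hs]
      simp only [nearestCount_of_mem_cell hx.2]
      rw [← ENNReal.ofReal_pow (Real.sqrt_nonneg _), Real.sq_sqrt (hb k)]
    · have hk' := Finset.mem_Ioo.1 hk
      exact Finset.mem_range.2 (by omega)
  · rw [lintegral_finsetSum_measure]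
    calc _ ≤ ENNReal.ofReal (∑ k ∈ Finset.Ioo 0 m,
          binomWeight m q k * (1 - cellEntropyBound m q k / 2)) :=
          ENNReal.ofReal_le_ofReal (one_sub_le_sum_inner_cells hm hκ h0 h1)
      _ ≤ ∑ k ∈ Finset.Ioo 0 m, ENNReal.ofReal
          (binomWeight m q k * (1 - cellEntropyBound m q k / 2)) := by
          exact Finset.le_sum_of_subadditive _ ENNReal.ofReal_zero.le
            (fun _ _ => ENNReal.ofReal_add_le) _ _
      _ ≤ _ := Finset.sum_le_sum fun k hk => by
          have hk' := Finset.mem_Ioo.1 hk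
          refine (le_lintegral_cell hm hq (by linarith) hk'.2.le).trans (le_of_eq ?_)
          refine setLIntegral_congr_fun (measurableSet_cell k) fun x hx => ?_
          simp only [nearestCount_of_mem_cell hx]
          rfl

/-! ### Hermitian involutions -/

section Involution

variable {d : Type} [Fintype d] [DecidableEq d] {A ρ : Matrix d d ℂ}

lemma mem_eigenspace_iff_toEuclideanCLM (A : Matrix d d ℂ) (a : ℝ) (v : EuclideanSpace ℂ d) :
    v ∈ Module.End.eigenspace (Matrix.toEuclideanLin A) (a : ℂ) ↔
      Matrix.toEuclideanCLM (n := d) (𝕜 := ℂ) A v = (a : ℂ) • v :=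
  Module.End.mem_eigenspace_iff

/-- (1 + εA)/2 is self-adjoint, maps into the eigenspace and fixes it pointwise. If ε is not an
eigenvalue, both sides are 0. -/
lemma eigenProj_eq_of_involution (hA : A.IsHermitian) (hA2 : A * A = 1) {ε : ℝ} (hε : ε * ε = 1) :
    eigenProj A ε = (1 / 2 : ℂ) • (1 + (ε : ℂ) • A) := by
  have hεc : (ε : ℂ) * ε = 1 := by exact_mod_cast hε
  set Q : Matrix d d ℂ := (1 / 2 : ℂ) • (1 + (ε : ℂ) • A) with hQ
  have hAQ : A * Q = (ε : ℂ) • Q := by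
    rw [hQ, Matrix.mul_smul, Matrix.mul_add, Matrix.mul_smul, hA2, Matrix.mul_one,
      smul_comm (ε : ℂ), smul_add (ε : ℂ), smul_smul, hεc, one_smul, add_comm]
  have hQs : star Q = Q := by
    rw [hQ, star_smul, star_add, star_smul, star_one, Matrix.star_eq_conjTranspose, hA.eq]
    simp
  set f := Matrix.toEuclideanCLM (n := d) (𝕜 := ℂ) with hf
  rw [eigenProj, ← hf, StarAlgEquiv.symm_apply_eq]
  ext1 v
  refine (Submodule.eq_starProjection_of_mem_of_inner_eq_zero ?_ fun w hw => ?_)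
  · rw [mem_eigenspace_iff_toEuclideanCLM, ← hf, ← mul_apply_eq_comp, ← map_mul, hAQ,
      map_smul]
    rfl
  · rw [mem_eigenspace_iff_toEuclideanCLM, ← hf] at hw
    have hw' : f Q w = w := by
      rw [hQ, map_smul, map_add, map_smul, map_one]
      change (1 / 2 : ℂ) • (w + (ε : ℂ) • f A w) = w
      rw [hw, smul_smul, hεc, one_smul, ← two_smul ℂ w, smul_smul]
      norm_num
    have hadj : star (f Q) = f Q := by rw [← map_star, hQs]
    rw [inner_sub_left, ← hadj, ContinuousLinearMap.star_eq_adjoint,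
      ContinuousLinearMap.adjoint_inner_left, hw', sub_self]

/-- The probability of the outcome `1` when the involution `A` is measured in the state `ρ`. -/
def successProb (A ρ : Matrix d d ℂ) : ℝ := (1 + (A * ρ).trace.re) / 2

lemma cellProb_of_involution (hA : A.IsHermitian) (hA2 : A * A = 1) (hρ : ρ.trace = 1) {ε : ℝ}
    (hε : ε * ε = 1) : cellProb A ρ ε = (1 + ε * (A * ρ).trace.re) / 2 := by
  rw [cellProb, eigenProj_eq_of_involution hA hA2 hε, Matrix.smul_mul, Matrix.add_mul,
    Matrix.smul_mul, Matrix.one_mul, Matrix.trace_smul, Matrix.trace_add, Matrix.trace_smul, hρ]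
  have : (1 / 2 : ℂ) • (1 + (ε : ℂ) • (A * ρ).trace) =
      ((1 / 2 : ℝ) : ℂ) * (1 + (ε : ℂ) * (A * ρ).trace) := by
    simp
  rw [this, Complex.re_ofReal_mul, Complex.add_re, Complex.re_ofReal_mul, Complex.one_re]
  ring

lemma cellProb_one (hA : A.IsHermitian) (hA2 : A * A = 1) (hρ : ρ.trace = 1) :
    cellProb A ρ 1 = successProb A ρ := by
  rw [cellProb_of_involution hA hA2 hρ (one_mul 1), one_mul, successProb]

lemma cellProb_neg_one (hA : A.IsHermitian) (hA2 : A * A = 1) (hρ : ρ.trace = 1) :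
    cellProb A ρ (-1) = 1 - successProb A ρ := by
  rw [cellProb_of_involution hA hA2 hρ (by norm_num), successProb]
  ring

/-- With Q Hermitian and idempotent, tr(Qρ) = tr(QρQᴴ), the trace of a positive semidefinite matrix.
-/
lemma cellProb_nonneg_of_involution (hA : A.IsHermitian) (hA2 : A * A = 1) (hρ : ρ.PosSemidef)
    {ε : ℝ} (hε : ε * ε = 1) : 0 ≤ cellProb A ρ ε := by
  have hεc : (ε : ℂ) * ε = 1 := by exact_mod_cast hε
  set Q := eigenProj A ε with hQ
  have hQ' := eigenProj_eq_of_involution hA hA2 hε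
  have hQs : Q.conjTranspose = Q := by
    rw [hQ, hQ', Matrix.conjTranspose_smul, Matrix.conjTranspose_add, Matrix.conjTranspose_smul,
      Matrix.conjTranspose_one, hA.eq]
    simp
  have hQQ : Q * Q = Q := by
    rw [hQ, hQ', Matrix.smul_mul, Matrix.mul_smul, Matrix.mul_add, Matrix.add_mul, Matrix.add_mul,
      Matrix.mul_one, Matrix.one_mul, Matrix.mul_one, Matrix.mul_smul, Matrix.smul_mul, hA2,
      smul_smul (ε : ℂ), hεc, one_smul]
    module
  have h := (hρ.mul_mul_conjTranspose_same Q).trace_nonneg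
  rw [hQs, Matrix.trace_mul_comm, ← Matrix.mul_assoc, hQQ] at h
  exact (Complex.le_def.1 h).1

lemma successProb_nonneg (hA : A.IsHermitian) (hA2 : A * A = 1) (hρ : IsDensity ρ) :
    0 ≤ successProb A ρ := by
  rw [← cellProb_one hA hA2 hρ.2]
  exact cellProb_nonneg_of_involution hA hA2 hρ.1 (one_mul 1)

lemma successProb_le_one (hA : A.IsHermitian) (hA2 : A * A = 1) (hρ : IsDensity ρ) :
    successProb A ρ ≤ 1 := by
  have h := cellProb_nonneg_of_involution hA hA2 hρ.1 (ε := -1) (by norm_num)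
  rw [cellProb_neg_one hA hA2 hρ.2] at h
  linarith

lemma eq_or_eq_of_mem_spectrum_involution (hA2 : A * A = 1) {a : ℝ} (ha : a ∈ spectrum ℝ A) :
    a = 1 ∨ a = -1 := by
  rw [← sq_eq_one_iff]
  by_contra h
  have h' : a ^ 2 - 1 ≠ 0 := sub_ne_zero.2 h
  refine ha ?_
  have e : (algebraMap ℝ (Matrix d d ℂ) a - A) * (algebraMap ℝ (Matrix d d ℂ) a + A) =
      algebraMap ℝ (Matrix d d ℂ) (a ^ 2 - 1) := by
    rw [sub_mul, mul_add, mul_add, hA2, Algebra.commutes a A, map_sub, map_pow, map_one, sq]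
    abel
  have hu : IsUnit (algebraMap ℝ (Matrix d d ℂ) (a ^ 2 - 1)) := (IsUnit.mk0 _ h').map _
  rw [← e] at hu
  have := hu
  rw [Matrix.isUnit_iff_isUnit_det, Matrix.det_mul] at this
  exact (Matrix.isUnit_iff_isUnit_det _).2 (isUnit_of_mul_isUnit_left this)

lemma mem_spectrum_of_involution (hA2 : A * A = 1) {ε : ℝ} (hε : ε * ε = 1)
    (hne : A ≠ algebraMap ℝ (Matrix d d ℂ) (-ε)) : ε ∈ spectrum ℝ A := by
  intro h
  have e : (algebraMap ℝ (Matrix d d ℂ) ε - A) * (algebraMap ℝ (Matrix d d ℂ) ε + A) = 0 := by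
    rw [sub_mul, mul_add, mul_add, hA2, Algebra.commutes ε A, ← map_mul, hε, map_one]
    abel
  rw [h.mul_right_eq_zero] at e
  refine hne ?_
  rw [map_neg]
  exact eq_neg_of_add_eq_zero_right e

/-- As A ≠ ±1, both eigenvalues occur; their probabilities are complementary, so both cells are
proper or neither is. -/
lemma two_le_ncard_properCells_iff (hA : A.IsHermitian) (hA2 : A * A = 1) (hρ : ρ.trace = 1)
    (h1 : A ≠ 1) (h2 : A ≠ -1) :
    2 ≤ (properCells A ρ).ncard ↔ 0 < successProb A ρ ∧ successProb A ρ < 1 := by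
  have m1 : (1 : ℝ) ∈ spectrum ℝ A := mem_spectrum_of_involution hA2 (one_mul 1) (by simpa using h2)
  have m2 : (-1 : ℝ) ∈ spectrum ℝ A :=
    mem_spectrum_of_involution hA2 (by norm_num) (by simpa using h1)
  have p1 : (⟨1, m1⟩ : spectrum ℝ A) ∈ properCells A ρ ↔
      0 < successProb A ρ ∧ successProb A ρ < 1 := by
    rw [properCells, Set.mem_ofPred_eq, cellProb_one hA hA2 hρ]
  have p2 : (⟨-1, m2⟩ : spectrum ℝ A) ∈ properCells A ρ ↔
      0 < successProb A ρ ∧ successProb A ρ < 1 := by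
    rw [properCells, Set.mem_ofPred_eq, cellProb_neg_one hA hA2 hρ]
    constructor <;> rintro ⟨h, h'⟩ <;> constructor <;> linarith
  rw [show (2 ≤ (properCells A ρ).ncard) ↔ 1 < (properCells A ρ).ncard from Iff.rfl,
    Set.one_lt_ncard]
  constructor
  · rintro ⟨⟨a, ha⟩, hap, -⟩
    rcases eq_or_eq_of_mem_spectrum_involution hA2 ha with rfl | rfl
    · exact p1.1 hap
    · exact p2.1 hap
  · intro h
    exact ⟨_, p1.2 h, _, p2.2 h, by rw [Ne, Subtype.mk.injEq]; norm_num⟩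

lemma ncard_properCells_one (hρ : ρ.trace = 1) : ¬ 2 ≤ (properCells (1 : Matrix d d ℂ) ρ).ncard := by
  have : properCells (1 : Matrix d d ℂ) ρ = ∅ := by
    rw [Set.eq_empty_iff_forall_notMem]
    rintro ⟨a, ha⟩ ⟨h0, h1⟩
    have hH : (1 : Matrix d d ℂ).IsHermitian := Matrix.isHermitian_one
    rcases eq_or_eq_of_mem_spectrum_involution (one_mul 1) ha with rfl | rfl
    · rw [cellProb_one hH (one_mul 1) hρ, successProb, Matrix.one_mul, hρ] at h1
      norm_num at h1
    · rw [cellProb_neg_one hH (one_mul 1) hρ, successProb, Matrix.one_mul, hρ] at h0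
      norm_num at h0
  rw [this, Set.ncard_empty]
  norm_num

end Involution

/-! ### The Pauli basis -/

lemma sigma_isHermitian (l : Fin 4) : (sigma l).IsHermitian := by
  ext i j
  fin_cases l <;> fin_cases i <;> fin_cases j <;> simp [sigma]

lemma sigma_mul_self (l : Fin 4) : sigma l * sigma l = 1 := by
  ext i j
  fin_cases l <;> fin_cases i <;> fin_cases j <;> simp [sigma, Matrix.mul_apply, Fin.sum_univ_two]

lemma sigma_trace {l : Fin 4} (hl : l ≠ 0) : (sigma l).trace = 0 := by
  fin_cases l <;> simp_all [sigma, Matrix.trace, Fin.sum_univ_two]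

lemma sum_pi_prod {b : ℕ} (f : Fin b → Fin 2 → ℂ) :
    ∑ x : Fin b → Fin 2, ∏ i, f i (x i) = ∏ i, ∑ a, f i a := by
  rw [Finset.prod_univ_sum, Fintype.piFinset_univ]

lemma pauli_isHermitian (b : ℕ) (l : Fin b → Fin 4) : (pauli b l).IsHermitian := by
  ext x y
  simp only [pauli, Matrix.conjTranspose_apply, Matrix.of_apply, star_prod]
  exact Finset.prod_congr rfl fun i _ => (sigma_isHermitian (l i)).apply _ _

lemma pauli_mul_self (b : ℕ) (l : Fin b → Fin 4) : pauli b l * pauli b l = 1 := by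
  ext x y
  simp only [pauli, Matrix.mul_apply, Matrix.of_apply, ← Finset.prod_mul_distrib]
  rw [sum_pi_prod fun i a => sigma (l i) (x i) a * sigma (l i) a (y i)]
  simp_rw [← Matrix.mul_apply, sigma_mul_self, Matrix.one_apply]
  rw [Finset.prod_ite_zero]
  simp [funext_iff]

lemma pauli_zero (b : ℕ) : pauli b 0 = 1 := by
  ext x y
  have h : sigma 0 = 1 := by
    ext i j
    fin_cases i <;> fin_cases j <;> simp [sigma]
  simp only [pauli, Matrix.of_apply, Pi.zero_apply, h, Matrix.one_apply]
  rw [Finset.prod_ite_zero]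
  simp [funext_iff]

lemma pauli_trace {b : ℕ} {l : Fin b → Fin 4} (hl : l ≠ 0) : (pauli b l).trace = 0 := by
  obtain ⟨i, hi⟩ := Function.ne_iff.1 hl
  simp only [Matrix.trace, Matrix.diag, pauli, Matrix.of_apply]
  rw [sum_pi_prod fun i a => sigma (l i) a a]
  exact Finset.prod_eq_zero (Finset.mem_univ i) (sigma_trace hi)

lemma pauli_ne_one {b : ℕ} {l : Fin b → Fin 4} (hl : l ≠ 0) : pauli b l ≠ 1 := by
  intro h
  have := pauli_trace hl
  rw [h, Matrix.trace_one] at this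
  simp at this

/-- Guarantees that 1 is an eigenvalue of every Pauli matrix, the identity included, so that the
success outcome always exists. -/
lemma pauli_ne_neg_one (b : ℕ) (l : Fin b → Fin 4) : pauli b l ≠ -1 := by
  rcases eq_or_ne l 0 with rfl | hl
  · rw [pauli_zero]
    intro h
    have := congrFun (congrFun h 0) 0
    simp at this
    norm_num [Complex.ext_iff] at this
  · intro h
    have := pauli_trace hl
    rw [h, Matrix.trace_neg, Matrix.trace_one] at this
    simp at this

lemma two_le_ncard_properCells_pauli_iff {b : ℕ} {l : Fin b → Fin 4}
    {ρ : Matrix (Fin b → Fin 2) (Fin b → Fin 2) ℂ} (hρ : ρ.trace = 1) :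
    2 ≤ (properCells (pauli b l) ρ).ncard ↔
      l ≠ 0 ∧ 0 < successProb (pauli b l) ρ ∧ successProb (pauli b l) ρ < 1 := by
  rcases eq_or_ne l 0 with rfl | hl
  · rw [pauli_zero]
    simp [ncard_properCells_one hρ]
  · rw [two_le_ncard_properCells_iff (pauli_isHermitian b l) (pauli_mul_self b l) hρ
      (pauli_ne_one hl) (pauli_ne_neg_one b l)]
    simp [hl]

/-! ### The product state -/

lemma sqrt_six_sevenths_sq : Real.sqrt (6 / 7) ^ 2 = 6 / 7 := Real.sq_sqrt (by norm_num)

lemma sqrt_one_fourteenth_sq : Real.sqrt (1 / 14) ^ 2 = 1 / 14 := Real.sq_sqrt (by norm_num)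

/-- The expectation of `σ_l` in the pure state `e`. -/
def blochCoord (l : Fin 4) : ℂ := ∑ a, ∑ c, sigma l a c * (qubit c * star (qubit a))

lemma blochCoord_zero : blochCoord 0 = 1 := by
  have h1 := sqrt_six_sevenths_sq
  have h2 := sqrt_one_fourteenth_sq
  rw [blochCoord, Complex.ext_iff]
  simp only [Fin.sum_univ_two, sigma, qubit]
  generalize Real.sqrt (6 / 7) = s at *
  generalize Real.sqrt (1 / 14) = t at *
  constructor
  · simp
    linarith
  · simp

lemma sum_qubit : ∑ a, qubit a * star (qubit a) = 1 := by
  rw [← blochCoord_zero]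
  simp [blochCoord, sigma]

lemma blochCoord_three : blochCoord 3 = ((5 / 7 : ℝ) : ℂ) := by
  have h1 := sqrt_six_sevenths_sq
  have h2 := sqrt_one_fourteenth_sq
  rw [blochCoord, Complex.ext_iff]
  simp only [Fin.sum_univ_two, sigma, qubit]
  generalize Real.sqrt (6 / 7) = s at *
  generalize Real.sqrt (1 / 14) = t at *
  constructor
  · simp
    linarith
  · simp

lemma blochCoord_one_two {l : Fin 4} (hl : l = 1 ∨ l = 2) :
    blochCoord l = ((2 * (Real.sqrt (6 / 7) * Real.sqrt (1 / 14)) : ℝ) : ℂ) := by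
  rw [blochCoord, Complex.ext_iff]
  simp only [Fin.sum_univ_two, sigma, qubit]
  generalize Real.sqrt (6 / 7) = s at *
  generalize Real.sqrt (1 / 14) = t at *
  rcases hl with rfl | rfl <;> constructor <;> simp <;> ring

lemma norm_blochCoord_lt {l : Fin 4} (hl : l ≠ 0) : ‖blochCoord l‖ < 1 := by
  have h : l = 1 ∨ l = 2 ∨ l = 3 := by omega
  rcases or_assoc.2 h with h | rfl
  · rw [blochCoord_one_two h, Complex.norm_real, Real.norm_eq_abs, ← sq_lt_one_iff_abs_lt_one,
      mul_pow, mul_pow, sqrt_six_sevenths_sq, sqrt_one_fourteenth_sq]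
    norm_num
  · rw [blochCoord_three, Complex.norm_real]
    norm_num

lemma norm_blochCoord_le (l : Fin 4) : ‖blochCoord l‖ ≤ 1 := by
  rcases eq_or_ne l 0 with rfl | hl
  · simp [blochCoord_zero]
  · exact (norm_blochCoord_lt hl).le

lemma productState_eq (b : ℕ) : productState b =
    Matrix.vecMulVec (fun x => ∏ i, qubit (x i)) (star fun x : Fin b → Fin 2 => ∏ i, qubit (x i)) :=
  rfl

lemma productState_isDensity (b : ℕ) : IsDensity (productState b) := by
  refine ⟨?_, ?_⟩
  · rw [productState_eq]
    exact Matrix.posSemidef_vecMulVec_self_star _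
  · simp only [Matrix.trace, Matrix.diag, productState, Matrix.of_apply, star_prod,
      ← Finset.prod_mul_distrib]
    rw [sum_pi_prod fun _ a => qubit a * star (qubit a), sum_qubit, Finset.prod_const_one]

lemma productState_rank (b : ℕ) : (productState b).rank = 1 := by
  refine le_antisymm ?_ (Nat.one_le_iff_ne_zero.2 fun h => ?_)
  · rw [productState_eq]
    exact Matrix.rank_vecMulVec_le _ _
  · have h0 : productState b = 0 := by
      rw [Matrix.rank, Submodule.finrank_eq_zero, LinearMap.range_eq_bot,
        ← Matrix.toLin'_apply'] at h
      exact (LinearEquiv.map_eq_zero_iff _).1 h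
    have h1 := (productState_isDensity b).2
    rw [h0, Matrix.trace_zero] at h1
    exact zero_ne_one h1

lemma trace_pauli_mul_productState (b : ℕ) (l : Fin b → Fin 4) :
    (pauli b l * productState b).trace = ∏ i, blochCoord (l i) := by
  simp only [Matrix.trace, Matrix.diag, Matrix.mul_apply, pauli, productState, Matrix.of_apply,
    star_prod, ← Finset.prod_mul_distrib]
  simp_rw [blochCoord, ← sum_pi_prod]

lemma successProb_productState {b : ℕ} {l : Fin b → Fin 4} (hl : l ≠ 0) :
    0 < successProb (pauli b l) (productState b) ∧
      successProb (pauli b l) (productState b) < 1 := by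
  obtain ⟨i, hi⟩ := Function.ne_iff.1 hl
  have h : ‖∏ i, blochCoord (l i)‖ < 1 := by
    rw [norm_prod, ← Finset.mul_prod_erase _ _ (Finset.mem_univ i)]
    exact mul_lt_one_of_nonneg_of_lt_one_left (norm_nonneg _) (norm_blochCoord_lt hi)
      (Finset.prod_le_one (fun _ _ => norm_nonneg _) fun _ _ => norm_blochCoord_le _)
  have h' := abs_lt.1 ((Complex.abs_re_le_norm _).trans_lt h)
  rw [successProb, trace_pauli_mul_productState]
  constructor <;> linarith [h'.1, h'.2]

/-! ### Transitions between the observations and the (smoothed) counts -/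

lemma bind_deterministic {X Y : Type*} [MeasurableSpace X] [MeasurableSpace Y] (μ : Measure X)
    {f : X → Y} (hf : Measurable f) : μ.bind (Kernel.deterministic f hf) = μ.map f :=
  Measure.bind_dirac_eq_map μ hf

lemma bind_comap {X Y Z : Type*} [MeasurableSpace X] [MeasurableSpace Y] [MeasurableSpace Z]
    (μ : Measure X) (κ : Kernel Y Z) {f : X → Y} (hf : Measurable f) :
    μ.bind (κ.comap f hf) = (μ.map f).bind κ := by
  refine Measure.ext_of_lintegral _ fun g hg => ?_
  rw [Measure.lintegral_bind (Kernel.aemeasurable _) hg.aemeasurable,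
    Measure.lintegral_bind (Kernel.aemeasurable _) hg.aemeasurable,
    lintegral_map hg.lintegral_kernel hf]
  rfl

/-- The sequence of outcomes with the successes at the positions in `s`. -/
def signVec {m : ℕ} (s : Finset (Fin m)) (i : Fin m) : ℝ := if i ∈ s then 1 else -1

/-- A uniformly distributed arrangement of `k` successes among `m` trials. -/
def arrangeKernel (m : ℕ) : Kernel ℕ (Fin m → ℝ) where
  -- Counts above m have no mass under `countLaw`; the point mass there is a default that keeps the
  -- kernel Markov.
  toFun k := if k ≤ m then ((m.choose k : ℝ≥0∞))⁻¹ •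
    ∑ s ∈ Finset.powersetCard k Finset.univ, Measure.dirac (signVec s) else Measure.dirac 0
  measurable' := measurable_from_nat

lemma arrangeKernel_apply {m k : ℕ} (hk : k ≤ m) : arrangeKernel m k = ((m.choose k : ℝ≥0∞))⁻¹ •
    ∑ s ∈ Finset.powersetCard k Finset.univ, Measure.dirac (signVec s) := if_pos hk

lemma lintegral_arrangeKernel {m k : ℕ} (hk : k ≤ m) {f : (Fin m → ℝ) → ℝ≥0∞}
    (hf : Measurable f) : ∫⁻ x, f x ∂(arrangeKernel m k) =
      (m.choose k : ℝ≥0∞)⁻¹ * ∑ s ∈ Finset.powersetCard k Finset.univ, f (signVec s) := by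
  rw [arrangeKernel_apply hk, lintegral_smul_measure, lintegral_finsetSum_measure, smul_eq_mul]
  simp_rw [lintegral_dirac' _ hf]

lemma inv_choose_mul_choose {m k : ℕ} (hk : k ≤ m) :
    (m.choose k : ℝ≥0∞)⁻¹ * (m.choose k : ℝ≥0∞) = 1 :=
  ENNReal.inv_mul_cancel (by exact_mod_cast (Nat.choose_pos hk).ne') (by simp)

instance (m : ℕ) : IsMarkovKernel (arrangeKernel m) := ⟨fun k => by
  by_cases hk : k ≤ m
  · constructor
    rw [← lintegral_one, lintegral_arrangeKernel (f := fun _ => 1) hk measurable_const]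
    simpa using inv_choose_mul_choose hk
  · rw [show arrangeKernel m k = Measure.dirac 0 from if_neg hk]
    infer_instance⟩

lemma arrangeKernel_map {m k : ℕ} (hk : k ≤ m) {Z : Type*} [MeasurableSpace Z]
    {g : (Fin m → ℝ) → Z} (hg : Measurable g) {z : Z}
    (h : ∀ s : Finset (Fin m), s.card = k → g (signVec s) = z) :
    (arrangeKernel m k).map g = Measure.dirac z := by
  refine Measure.ext_of_lintegral _ fun f hf => ?_
  rw [lintegral_map hf hg, lintegral_arrangeKernel (f := fun x => f (g x)) hk (hf.comp hg), lintegral_dirac' _ hf,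
    Finset.sum_congr rfl fun s hs => by rw [h s (Finset.mem_powersetCard.1 hs).2],
    Finset.sum_const, Finset.card_powersetCard, Finset.card_univ, Fintype.card_fin, nsmul_eq_mul,
    ← mul_assoc, inv_choose_mul_choose hk, one_mul]

/-- The law of a single binary outcome. -/
def signLaw (q : ℝ) : Measure ℝ :=
  ENNReal.ofReal q • Measure.dirac 1 + ENNReal.ofReal (1 - q) • Measure.dirac (-1)

lemma isProbabilityMeasure_signLaw {q : ℝ} (h0 : 0 ≤ q) (h1 : q ≤ 1) :
    IsProbabilityMeasure (signLaw q) := by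
  constructor
  simp only [signLaw, Measure.add_apply, Measure.smul_apply, measure_univ, smul_eq_mul, mul_one]
  rw [← ENNReal.ofReal_add h0 (by linarith)]
  simp

/-- Sufficiency of the count. On a rectangle the product of the two-term sums expands over the sets
of successes; grouping these by cardinality cancels the binomial coefficient against the uniform
weights. -/
lemma pi_signLaw_eq {m : ℕ} {q : ℝ} (h0 : 0 ≤ q) (h1 : q ≤ 1) :
    (Measure.pi fun _ : Fin m => signLaw q) = (countLaw m q).bind (arrangeKernel m) := by
  have := isProbabilityMeasure_signLaw h0 h1
  have h2 : 0 ≤ 1 - q := by linarith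
  refine Measure.pi_eq fun t ht => ?_
  rw [Measure.bind_apply (MeasurableSet.univ_pi ht) (Kernel.aemeasurable _), lintegral_countLaw]
  have hprod : ∀ s : Finset (Fin m),
      (Set.univ.pi t).indicator (fun _ => (1 : ℝ≥0∞)) (signVec s) =
        (∏ i ∈ s, (t i).indicator (fun _ => (1 : ℝ≥0∞)) 1) *
          ∏ i ∈ Finset.univ \ s, (t i).indicator (fun _ => (1 : ℝ≥0∞)) (-1) := by
    intro s
    have e : (Set.univ.pi t).indicator (fun _ => (1 : ℝ≥0∞)) (signVec s) =
        ∏ i, (t i).indicator (fun _ => (1 : ℝ≥0∞)) (signVec s i) := by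
      by_cases hx : signVec s ∈ Set.univ.pi t
      · rw [Set.indicator_of_mem hx]
        exact (Finset.prod_eq_one fun i _ => Set.indicator_of_mem (hx i trivial) _).symm
      · rw [Set.indicator_of_notMem hx]
        simp only [Set.mem_univ_pi, not_forall] at hx
        obtain ⟨i, hi⟩ := hx
        exact (Finset.prod_eq_zero (Finset.mem_univ i) (Set.indicator_of_notMem hi _)).symm
    rw [e, ← Finset.prod_sdiff (Finset.subset_univ s), mul_comm]
    congr 1
    · exact Finset.prod_congr rfl fun i hi => by rw [signVec, if_pos hi]
    · exact Finset.prod_congr rfl fun i hi => by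
        rw [signVec, if_neg (Finset.mem_sdiff.1 hi).2]
  have hl : ∀ i, signLaw q (t i) = ENNReal.ofReal q * (t i).indicator (fun _ => (1 : ℝ≥0∞)) 1 +
      ENNReal.ofReal (1 - q) * (t i).indicator (fun _ => (1 : ℝ≥0∞)) (-1) := fun i => by
    simp only [signLaw, Measure.add_apply, Measure.smul_apply, Measure.dirac_apply' _ (ht i),
      smul_eq_mul]
    rfl
  simp_rw [hl]
  rw [Finset.prod_add, Finset.sum_powerset, Finset.card_univ, Fintype.card_fin]
  refine Finset.sum_congr rfl fun k hk => ?_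
  have hk : k ≤ m := Finset.mem_range_succ_iff.1 hk
  have hm : Measurable ((Set.univ.pi t).indicator fun _ : Fin m → ℝ => (1 : ℝ≥0∞)) :=
    measurable_const.indicator (MeasurableSet.univ_pi ht)
  have e2 : arrangeKernel m k (Set.univ.pi t) = (m.choose k : ℝ≥0∞)⁻¹ *
      ∑ s ∈ Finset.powersetCard k Finset.univ,
        (Set.univ.pi t).indicator (fun _ => (1 : ℝ≥0∞)) (signVec s) := by
    rw [← lintegral_arrangeKernel hk hm, lintegral_indicator (MeasurableSet.univ_pi ht)]
    simp
  rw [e2, binomWeight, mul_assoc, ENNReal.ofReal_mul (by positivity), ENNReal.ofReal_natCast,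
    ENNReal.ofReal_mul (by positivity), ENNReal.ofReal_pow h0, ENNReal.ofReal_pow h2,
    mul_comm (m.choose k : ℝ≥0∞), mul_assoc, ← mul_assoc (m.choose k : ℝ≥0∞),
    mul_comm (m.choose k : ℝ≥0∞) (_)⁻¹, inv_choose_mul_choose hk, one_mul, Finset.mul_sum]
  refine Finset.sum_congr rfl fun s hs => ?_
  have hs : s.card = k := (Finset.mem_powersetCard.1 hs).2
  rw [hprod, Finset.prod_mul_distrib, Finset.prod_mul_distrib, Finset.prod_const,
    Finset.prod_const, Finset.card_sdiff_of_subset (Finset.subset_univ s), Finset.card_univ,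
    Fintype.card_fin, hs]
  ring

lemma countLaw_bind_arrangeKernel_map {m : ℕ} {q : ℝ} {Z : Type*} [MeasurableSpace Z]
    {g : (Fin m → ℝ) → Z} (hg : Measurable g) (z : ℕ → Z)
    (h : ∀ s : Finset (Fin m), g (signVec s) = z s.card) :
    ((countLaw m q).bind (arrangeKernel m)).map g = (countLaw m q).map z := by
  refine Measure.ext_of_lintegral _ fun f hf => ?_
  rw [lintegral_map hf hg, lintegral_map hf measurable_from_nat,
    Measure.lintegral_bind (f := fun x => f (g x)) (Kernel.aemeasurable _)
      (hf.comp hg).aemeasurable, lintegral_countLaw, lintegral_countLaw]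
  refine Finset.sum_congr rfl fun k hk => ?_
  have hk : k ≤ m := Finset.mem_range_succ_iff.1 hk
  rw [← lintegral_map hf hg, arrangeKernel_map hk hg fun s hs => (h s).trans (by rw [hs]),
    lintegral_dirac' _ hf]

lemma sum_signVec {m : ℕ} (s : Finset (Fin m)) : ∑ i, signVec s i = 2 * s.card - m := by
  have h : ∀ i, signVec s i = 2 * (if i ∈ s then 1 else 0) - 1 := fun i => by
    rw [signVec]
    split_ifs <;> norm_num
  simp_rw [h]
  rw [Finset.sum_sub_distrib, ← Finset.mul_sum, Finset.sum_ite_mem]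
  simp

/-- The count that yields the average `y` of `m` signs. -/
def countOfAverage (m : ℕ) (y : ℝ) : ℕ := nearestCount (m * (y + 1) / 2)

lemma measurable_countOfAverage (m : ℕ) : Measurable (countOfAverage m) :=
  measurable_nearestCount.comp (by fun_prop)

lemma countOfAverage_eq {m : ℕ} (hm : 0 < m) (k : ℕ) :
    countOfAverage m ((2 * k - m) / m) = k := by
  have : (m : ℝ) ≠ 0 := by exact_mod_cast hm.ne'
  rw [countOfAverage, show (m : ℝ) * ((2 * k - m) / m + 1) / 2 = k by field_simp; ring,
    nearestCount_natCast]

/-! ### Laws of the data from a measured involution, in terms of the count and the normal law -/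

section Observable

variable {d : Type} [Fintype d] [DecidableEq d] {A ρ : Matrix d d ℂ}

lemma outcomeLaw_eq (hA : A.IsHermitian) (hA2 : A * A = 1) (hA1 : A ≠ -1) (hρ : ρ.trace = 1) :
    outcomeLaw A ρ = signLaw (successProb A ρ) := by
  classical
  set G : ℝ → Measure ℝ := fun a => ENNReal.ofReal (cellProb A ρ a) • Measure.dirac a with hG
  have h1 : outcomeLaw A ρ = ∑ a ∈ (spectrum ℝ A).toFinset, G a := by
    rw [outcomeLaw]
    exact (Finset.sum_set_coe _ (f := G))
  have h2 : ∑ a ∈ (spectrum ℝ A).toFinset, G a = ∑ a ∈ ({1, -1} : Finset ℝ), G a := by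
    refine Finset.sum_subset (fun a ha => ?_) fun a ha ha' => ?_
    · simpa using eq_or_eq_of_mem_spectrum_involution hA2 (Set.mem_toFinset.1 ha)
    · rw [Set.mem_toFinset] at ha'
      rcases Finset.mem_insert.1 ha with rfl | ha
      · exact absurd (mem_spectrum_of_involution hA2 (one_mul 1) (by simpa using hA1)) ha'
      · obtain rfl := Finset.mem_singleton.1 ha
        -- If -1 is not an eigenvalue, A is the identity and the added term has weight 0.
        have hA1' : A = 1 := by
          by_contra h
          exact ha' (mem_spectrum_of_involution hA2 (by norm_num) (by simpa using h))
        rw [hG]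
        simp only
        rw [cellProb_neg_one hA hA2 hρ, hA1', successProb, Matrix.one_mul, hρ]
        norm_num
  rw [h1, h2, Finset.sum_pair (by norm_num), hG]
  simp only
  rw [cellProb_one hA hA2 hρ, cellProb_neg_one hA hA2 hρ, signLaw]

lemma individualLaw_eq (m : ℕ) (hA : A.IsHermitian) (hA2 : A * A = 1) (hA1 : A ≠ -1)
    (hρ : IsDensity ρ) :
    individualLaw m A ρ = (countLaw m (successProb A ρ)).bind (arrangeKernel m) := by
  rw [individualLaw, outcomeLaw_eq hA hA2 hA1 hρ.2,
    pi_signLaw_eq (successProb_nonneg hA hA2 hρ) (successProb_le_one hA hA2 hρ)]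

lemma averageLaw_eq (m : ℕ) (hA : A.IsHermitian) (hA2 : A * A = 1) (hA1 : A ≠ -1)
    (hρ : IsDensity ρ) :
    averageLaw m A ρ = (countLaw m (successProb A ρ)).map fun k : ℕ => ((2 * k - m : ℝ) / m) := by
  rw [averageLaw, individualLaw_eq m hA hA2 hA1 hρ]
  exact countLaw_bind_arrangeKernel_map (by fun_prop) _ fun s => by rw [sum_signVec]

lemma individualLaw_map_count {m : ℕ} (hm : 0 < m) (hA : A.IsHermitian) (hA2 : A * A = 1)
    (hA1 : A ≠ -1) (hρ : IsDensity ρ) :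
    (individualLaw m A ρ).map (fun R => countOfAverage m ((∑ l, R l) / m)) =
      countLaw m (successProb A ρ) := by
  have hg : Measurable fun R : Fin m → ℝ => countOfAverage m ((∑ l, R l) / m) :=
    (measurable_countOfAverage m).comp (by fun_prop)
  rw [individualLaw_eq m hA hA2 hA1 hρ, countLaw_bind_arrangeKernel_map hg id, Measure.map_id]
  intro s
  rw [sum_signVec, countOfAverage_eq hm, id]

lemma averageLaw_map_count {m : ℕ} (hm : 0 < m) (hA : A.IsHermitian) (hA2 : A * A = 1)
    (hA1 : A ≠ -1) (hρ : IsDensity ρ) :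
    (averageLaw m A ρ).map (countOfAverage m) = countLaw m (successProb A ρ) := by
  rw [averageLaw, Measure.map_map (measurable_countOfAverage m) (by fun_prop)]
  exact individualLaw_map_count hm hA hA2 hA1 hρ

lemma regressionLaw_eq {m : ℕ} (hm : 0 < m) (hA : A.IsHermitian) (hA2 : A * A = 1)
    (hρ : IsDensity ρ) :
    regressionLaw m A ρ =
      (normalLaw m (successProb A ρ)).map fun x => (2 / m : ℝ) * x - 1 := by
  have hmr : (0 : ℝ) < m := by exact_mod_cast hm
  have h0 := successProb_nonneg hA hA2 hρ
  have h1 : 0 ≤ 1 - successProb A ρ := by linarith [successProb_le_one hA hA2 hρ]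
  have hq : (A * ρ).trace.re = 2 * successProb A ρ - 1 := by rw [successProb]; ring
  have e : (fun x => (2 / m : ℝ) * x - 1) = (fun x : ℝ => x + (-1)) ∘ fun x => (2 / m : ℝ) * x :=
    funext fun x => by simp [sub_eq_add_neg]
  rw [e, ← Measure.map_map (by fun_prop) (by fun_prop), normalLaw, gaussianReal_map_const_mul,
    gaussianReal_map_add_const, regressionLaw, hA.eq, hA2, Matrix.one_mul, hρ.2, hq,
    Complex.one_re]
  congr 1
  · field_simp
    ring
  · rw [← NNReal.coe_inj]
    have e1 : (0 : ℝ) ≤ (1 - (2 * successProb A ρ - 1) ^ 2) / m := by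
      refine div_nonneg ?_ hmr.le
      nlinarith [mul_nonneg h0 h1]
    have e2 : (0 : ℝ) ≤ m * successProb A ρ * (1 - successProb A ρ) := by positivity
    rw [NNReal.coe_mul, Real.coe_toNNReal _ e2]
    refine (Real.coe_toNNReal _ e1).trans ?_
    simp only [NNReal.coe_mk]
    field_simp
    ring

lemma regressionLaw_map {m : ℕ} (hm : 0 < m) (hA : A.IsHermitian) (hA2 : A * A = 1)
    (hρ : IsDensity ρ) :
    (regressionLaw m A ρ).map (fun y => (m : ℝ) * (y + 1) / 2) = normalLaw m (successProb A ρ) := by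
  have hmr : (m : ℝ) ≠ 0 := by exact_mod_cast hm.ne'
  rw [regressionLaw_eq hm hA hA2 hρ, Measure.map_map (by fun_prop) (by fun_prop)]
  convert Measure.map_id using 2
  funext x
  simp
  field_simp

/-- The frequencies of all outcomes as a function of the number of successes. -/
def frequencyVec (m : ℕ) (A : Matrix d d ℂ) (x : ℝ) : EuclideanSpace ℝ (spectrum ℝ A) :=
  WithLp.toLp 2 (fun a : spectrum ℝ A => if (a : ℝ) = 1 then (0 : ℝ) else 1) +
    x • WithLp.toLp 2 (fun a : spectrum ℝ A => if (a : ℝ) = 1 then (1 / m : ℝ) else -(1 / m))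

lemma measurable_frequencyVec (m : ℕ) (A : Matrix d d ℂ) : Measurable (frequencyVec m A) := by
  unfold frequencyVec
  fun_prop

lemma cellProb_eq_ite (hA : A.IsHermitian) (hA2 : A * A = 1) (hρ : ρ.trace = 1)
    (a : spectrum ℝ A) :
    cellProb A ρ a = if (a : ℝ) = 1 then successProb A ρ else 1 - successProb A ρ := by
  rcases eq_or_eq_of_mem_spectrum_involution hA2 a.2 with h | h
  · rw [if_pos h, h, cellProb_one hA hA2 hρ]
  · rw [if_neg (by rw [h]; norm_num), h, cellProb_neg_one hA hA2 hρ]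

/-- With at most two outcomes the errors are opposite multiples of one variable, so the covariance
has rank at most one. -/
lemma fineCov_eq {m : ℕ} (hm : 0 < m) (hA : A.IsHermitian) (hA2 : A * A = 1)
    (hρ : ρ.trace = 1) :
    fineCov m A ρ = (m * successProb A ρ * (1 - successProb A ρ)) •
      Matrix.vecMulVec (fun a : spectrum ℝ A => if (a : ℝ) = 1 then (1 / m : ℝ) else -(1 / m))
        (fun a : spectrum ℝ A => if (a : ℝ) = 1 then (1 / m : ℝ) else -(1 / m)) := by
  have hmr : (m : ℝ) ≠ 0 := by exact_mod_cast hm.ne'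
  ext a b
  simp only [fineCov, Matrix.of_apply, Matrix.smul_apply, Matrix.vecMulVec_apply, smul_eq_mul]
  rw [cellProb_eq_ite hA hA2 hρ, cellProb_eq_ite hA hA2 hρ]
  by_cases hab : a = b
  · subst hab
    rw [if_pos rfl]
    split_ifs <;> field_simp
    ring
  · rw [if_neg hab]
    have hab' : (a : ℝ) ≠ b := fun h => hab (Subtype.ext h)
    rcases eq_or_eq_of_mem_spectrum_involution hA2 a.2 with h | h <;>
      rcases eq_or_eq_of_mem_spectrum_involution hA2 b.2 with h' | h'
    · exact absurd (h.trans h'.symm) hab'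
    · rw [if_pos h, if_neg (by rw [h']; norm_num), if_pos h, if_neg (by rw [h']; norm_num)]
      field_simp
    · rw [if_neg (by rw [h]; norm_num), if_pos h', if_neg (by rw [h]; norm_num), if_pos h']
      field_simp
    · exact absurd (h.trans h'.symm) hab'

lemma fineRegressionLaw_eq {m : ℕ} (hm : 0 < m) (hA : A.IsHermitian) (hA2 : A * A = 1)
    (hρ : IsDensity ρ) :
    fineRegressionLaw m A ρ = (normalLaw m (successProb A ρ)).map (frequencyVec m A) := by
  have hmr : (0 : ℝ) < m := by exact_mod_cast hm
  have h0 := successProb_nonneg hA hA2 hρ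
  have h1 : 0 ≤ 1 - successProb A ρ := by linarith [successProb_le_one hA hA2 hρ]
  set q := successProb A ρ with hq
  have hs : 0 ≤ m * q * (1 - q) := by positivity
  set w : spectrum ℝ A → ℝ := fun a => if (a : ℝ) = 1 then (1 / m : ℝ) else -(1 / m) with hw
  set c : spectrum ℝ A → ℝ := fun a => if (a : ℝ) = 1 then (0 : ℝ) else 1 with hc
  have hF : ∀ x, frequencyVec m A x = WithLp.toLp 2 c + x • WithLp.toLp 2 w := fun x => rfl
  have hcov : fineCov m A ρ = (m * q * (1 - q)) • Matrix.vecMulVec w w :=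
    fineCov_eq hm hA hA2 hρ.2
  have hpsd : (fineCov m A ρ).PosSemidef := by
    rw [hcov]
    exact (Matrix.posSemidef_vecMulVec_self_star w).smul hs
  have hmean : (WithLp.toLp 2 fun a : spectrum ℝ A => cellProb A ρ a) =
      frequencyVec m A (m * q) := by
    ext a
    simp only [frequencyVec, PiLp.add_apply, PiLp.smul_apply, smul_eq_mul]
    rw [cellProb_eq_ite hA hA2 hρ.2, ← hq]
    split_ifs <;> (field_simp; ring)
  have := (measurable_frequencyVec m A).aemeasurable (μ := normalLaw m q)
  have : IsProbabilityMeasure ((normalLaw m q).map (frequencyVec m A)) :=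
    Measure.isProbabilityMeasure_map this
  have : IsProbabilityMeasure (fineRegressionLaw m A ρ) := by
    unfold fineRegressionLaw
    infer_instance
  -- Both characteristic functions depend on t only through its inner products with the offset `c`
  -- and the direction `w`.
  refine Measure.ext_of_charFun (funext fun t => ?_)
  rw [fineRegressionLaw, charFun_multivariateGaussian hpsd, hmean, charFun_apply,
    integral_map (measurable_frequencyVec m A).aemeasurable (by fun_prop)]
  have e1 : ∀ x : ℝ, Complex.exp ((inner ℝ (frequencyVec m A x) t : ℝ) * Complex.I) =
      Complex.exp ((inner ℝ (WithLp.toLp 2 c) t : ℝ) * Complex.I) *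
        Complex.exp ((inner ℝ (WithLp.toLp 2 w) t : ℝ) * x * Complex.I) := by
    intro x
    rw [← Complex.exp_add, hF, inner_add_left, real_inner_smul_left]
    push_cast
    congr 1
    ring
  simp_rw [e1]
  rw [integral_const_mul, ← charFun_apply_real, normalLaw, charFun_gaussianReal, ← Complex.exp_add,
    Real.coe_toNNReal _ hs, hcov]
  have e2 : t.ofLp ⬝ᵥ ((m * q * (1 - q)) • Matrix.vecMulVec w w).mulVec t.ofLp =
      m * q * (1 - q) * (inner ℝ (WithLp.toLp 2 w) t) ^ 2 := by
    have e3 : w ⬝ᵥ t.ofLp = inner ℝ (WithLp.toLp 2 w) t := by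
      simp [PiLp.inner_apply, dotProduct, mul_comm]
    rw [Matrix.smul_mulVec, Matrix.vecMulVec_mulVec, dotProduct_smul, ← e3]
    rw [op_smul_eq_smul, dotProduct_smul, dotProduct_comm t.ofLp w, smul_eq_mul, smul_eq_mul, sq]
  rw [e2, hF, real_inner_comm, inner_add_left, real_inner_smul_left]
  push_cast
  congr 1
  ring

lemma fineRegressionLaw_map {m : ℕ} (hm : 0 < m) (hA : A.IsHermitian) (hA2 : A * A = 1)
    (hρ : IsDensity ρ) (h1 : (1 : ℝ) ∈ spectrum ℝ A) :
    (fineRegressionLaw m A ρ).map (fun y => (m : ℝ) * y ⟨1, h1⟩) =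
      normalLaw m (successProb A ρ) := by
  have hmr : (m : ℝ) ≠ 0 := by exact_mod_cast hm.ne'
  rw [fineRegressionLaw_eq hm hA hA2 hρ, Measure.map_map (by fun_prop)
    (measurable_frequencyVec m A)]
  convert Measure.map_id using 2
  funext x
  simp [frequencyVec]
  field_simp

end Observable

/-! ### The degenerate laws -/

lemma smoothLaw_zero (m : ℕ) : smoothLaw m 0 = Measure.dirac 0 := by
  refine Measure.ext_of_lintegral _ fun f hf => ?_
  rw [smoothLaw, Measure.lintegral_bind (Kernel.aemeasurable _) hf.aemeasurable, lintegral_countLaw,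
    Finset.sum_eq_single 0 (fun k _ hk => by simp [binomWeight, hk]) (by simp)]
  rw [smoothKernel_apply, if_pos (Or.inl rfl)]
  simp [binomWeight, lintegral_dirac' _ hf]

lemma smoothLaw_one (m : ℕ) : smoothLaw m 1 = Measure.dirac (m : ℝ) := by
  refine Measure.ext_of_lintegral _ fun f hf => ?_
  rw [smoothLaw, Measure.lintegral_bind (Kernel.aemeasurable _) hf.aemeasurable, lintegral_countLaw,
    Finset.sum_eq_single m (fun k hk hkm => ?_) (by simp)]
  · rw [smoothKernel_apply, if_pos (Or.inr rfl)]
    simp [binomWeight, lintegral_dirac' _ hf]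
  · have : m - k ≠ 0 := by
      have := Finset.mem_range.1 hk
      omega
    simp [binomWeight, this]

/-- This exact agreement is why `smoothKernel` leaves the counts 0 and m unspread: a degenerate
observable then costs nothing. -/
lemma normalLaw_eq_smoothLaw_of_degenerate (m : ℕ) {q : ℝ} (hq : q = 0 ∨ q = 1) :
    normalLaw m q = smoothLaw m q := by
  rcases hq with rfl | rfl
  · simp [normalLaw, smoothLaw_zero, gaussianReal_zero_var]
  · simp [normalLaw, smoothLaw_one, gaussianReal_zero_var]

lemma affinityGE_of_degenerate_or_bounds {m : ℕ} (hm : 0 < m) {q κ : ℝ} (hκ : 0 < κ)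
    (hq : (q = 0 ∨ q = 1) ∨ (κ ≤ q ∧ κ ≤ 1 - q)) :
    AffinityGE (normalLaw m q) (smoothLaw m q) (ENNReal.ofReal (1 - 5 / (κ ^ 2 * m))) := by
  rcases hq with hq | hq
  · rw [← normalLaw_eq_smoothLaw_of_degenerate m hq]
    refine (AffinityGE.refl _).mono ?_
    rw [ENNReal.ofReal_le_one]
    have : (0 : ℝ) ≤ 5 / (κ ^ 2 * m) := by positivity
    linarith
  · exact affinityGE_normalLaw_smoothLaw hm hκ hq.1 hq.2

/-! ### Deficiency bounds for binary observables -/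

section Bounds

variable {J d : Type} [Fintype d] [DecidableEq d] {B : J → Matrix d d ℂ}
  {Θ : Set (Matrix d d ℂ)}

lemma successProb_degenerate_or_bounds (hB : ∀ j, (B j).IsHermitian) (hB2 : ∀ j, B j * B j = 1)
    (hB1 : ∀ j, B j ≠ -1) (hΘ : ∀ ρ ∈ Θ, IsDensity ρ) {c₀ c₁ : ℝ} (h : CellBounds B c₀ c₁ Θ)
    {ρ : Matrix d d ℂ} (hρ : ρ ∈ Θ) (j : J) :
    (successProb (B j) ρ = 0 ∨ successProb (B j) ρ = 1) ∨
      (min c₀ (1 - c₁) ≤ successProb (B j) ρ ∧ min c₀ (1 - c₁) ≤ 1 - successProb (B j) ρ) := by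
  have h0 := successProb_nonneg (hB j) (hB2 j) (hΘ ρ hρ)
  have h1 := successProb_le_one (hB j) (hB2 j) (hΘ ρ hρ)
  rcases h0.eq_or_lt with h0 | h0
  · exact Or.inl (Or.inl h0.symm)
  rcases h1.eq_or_lt with h1 | h1
  · exact Or.inl (Or.inr h1)
  have hmem : (1 : ℝ) ∈ spectrum ℝ (B j) :=
    mem_spectrum_of_involution (hB2 j) (one_mul 1) (by simpa using hB1 j)
  have e := cellProb_one (hB j) (hB2 j) (hΘ ρ hρ).2
  have hb := h ρ hρ j ⟨1, hmem⟩ (by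
    rw [properCells, Set.mem_ofPred_eq, e]
    exact ⟨h0, h1⟩)
  rw [e] at hb
  exact Or.inr ⟨(min_le_left _ _).trans hb.1, (min_le_right _ _).trans (by linarith [hb.2])⟩

variable [Fintype J] (w : PMF J) (n : ℕ) {m : ℕ} {κ : ℝ}

/-- In each of the four directions the data are first carried to the normal or smoothed binomial
law, then the other of these two laws is carried to the target data. Smoothing applied after
counting, and arranging applied after rounding, are the only randomized transitions. -/
lemma deficiencyDist_regression_tomography_le (hB : ∀ j, (B j).IsHermitian)
    (hB2 : ∀ j, B j * B j = 1) (hB1 : ∀ j, B j ≠ -1) (hΘ : ∀ ρ ∈ Θ, IsDensity ρ) (hm : 0 < m)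
    (hκ : 0 < κ) (hb : ∀ ρ ∈ Θ, ∀ j, (successProb (B j) ρ = 0 ∨ successProb (B j) ρ = 1) ∨
      (κ ≤ successProb (B j) ρ ∧ κ ≤ 1 - successProb (B j) ρ)) :
    deficiencyDist (fun ρ : Θ => traceRegression B w m n ρ)
        (fun ρ : Θ => tomographySummarized B w m n ρ) ≤
      ENNReal.ofReal (Real.sqrt (2 * (n * (5 / (κ ^ 2 * m))))) ∧
    deficiencyDist (fun ρ : Θ => fineTraceRegression B w m n ρ)
        (fun ρ : Θ => tomographyIndividual B w m n ρ) ≤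
      ENNReal.ofReal (Real.sqrt (2 * (n * (5 / (κ ^ 2 * m))))) := by
  have hε : (0 : ℝ) ≤ 5 / (κ ^ 2 * m) := by positivity
  have hmem : ∀ j, (1 : ℝ) ∈ spectrum ℝ (B j) := fun j =>
    mem_spectrum_of_involution (hB2 j) (one_mul 1) (by simpa using hB1 j)
  have hS : ∀ (ρ : Θ) j, IsProbabilityMeasure (smoothLaw m (successProb (B j) ρ)) := fun ρ j =>
    isProbabilityMeasure_smoothLaw m (successProb_nonneg (hB j) (hB2 j) (hΘ ρ ρ.2))
      (successProb_le_one (hB j) (hB2 j) (hΘ ρ ρ.2))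
  have hC : ∀ (ρ : Θ) j, IsProbabilityMeasure (countLaw m (successProb (B j) ρ)) := fun ρ j =>
    isProbabilityMeasure_countLaw m (successProb_nonneg (hB j) (hB2 j) (hΘ ρ ρ.2))
      (successProb_le_one (hB j) (hB2 j) (hΘ ρ ρ.2))
  have hR : ∀ (ρ : Θ) j, IsProbabilityMeasure (regressionLaw m (B j) ρ) := fun ρ j => by
    unfold regressionLaw
    infer_instance
  have hF : ∀ (ρ : Θ) j, IsProbabilityMeasure (fineRegressionLaw m (B j) ρ) := fun ρ j => by
    unfold fineRegressionLaw
    infer_instance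
  have hI : ∀ (ρ : Θ) j, IsProbabilityMeasure (individualLaw m (B j) ρ) := fun ρ j => by
    rw [individualLaw_eq m (hB j) (hB2 j) (hB1 j) (hΘ ρ ρ.2)]
    infer_instance
  have hA : ∀ (ρ : Θ) j, IsProbabilityMeasure (averageLaw m (B j) ρ) := fun ρ j =>
    Measure.isProbabilityMeasure_map (by fun_prop)
  have haff : ∀ (ρ : Θ) j, AffinityGE (normalLaw m (successProb (B j) ρ))
      (smoothLaw m (successProb (B j) ρ)) (ENNReal.ofReal (1 - 5 / (κ ^ 2 * m))) := fun ρ j =>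
    affinityGE_of_degenerate_or_bounds hm hκ (hb ρ ρ.2 j)
  have hcountAvg : Measurable fun R : Fin m → ℝ => countOfAverage m ((∑ l, R l) / m) :=
    (measurable_countOfAverage m).comp (by fun_prop)
  have havg : Measurable fun x : ℝ => ((2 * nearestCount x - m : ℝ) / m) :=
    (measurable_from_nat (f := fun k : ℕ => ((2 * k - m : ℝ) / m))).comp measurable_nearestCount
  refine ⟨max_le ?_ ?_, max_le ?_ ?_⟩
  · refine deficiency_pi_mixture_le w
      (fun _ => Kernel.deterministic (fun y : ℝ => (m : ℝ) * (y + 1) / 2) (by fun_prop))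
      (fun _ => Kernel.deterministic _ havg) (fun ρ j => ?_) (fun ρ j => ?_) hε haff n
    · rw [bind_deterministic, regressionLaw_map hm (hB j) (hB2 j) (hΘ ρ ρ.2)]
    · rw [bind_deterministic, averageLaw_eq m (hB j) (hB2 j) (hB1 j) (hΘ ρ ρ.2),
        ← smoothLaw_map_nearestCount, Measure.map_map measurable_from_nat measurable_nearestCount]
      rfl
  · refine deficiency_pi_mixture_le w
      (fun _ => (smoothKernel m).comap _ (measurable_countOfAverage m))
      (fun _ => Kernel.deterministic (fun x : ℝ => (2 / m : ℝ) * x - 1) (by fun_prop))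
      (fun ρ j => ?_) (fun ρ j => ?_) hε (fun ρ j => (haff ρ j).symm) n
    · rw [bind_comap, averageLaw_map_count hm (hB j) (hB2 j) (hB1 j) (hΘ ρ ρ.2)]
      rfl
    · rw [bind_deterministic, regressionLaw_eq hm (hB j) (hB2 j) (hΘ ρ ρ.2)]
  · refine deficiency_pi_mixture_le w
      (fun j => Kernel.deterministic
        (fun y : EuclideanSpace ℝ (spectrum ℝ (B j)) => (m : ℝ) * y ⟨1, hmem j⟩) (by fun_prop))
      (fun _ => (arrangeKernel m).comap _ measurable_nearestCount)
      (fun ρ j => ?_) (fun ρ j => ?_) hε haff n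
    · rw [bind_deterministic, fineRegressionLaw_map hm (hB j) (hB2 j) (hΘ ρ ρ.2)]
    · rw [bind_comap, smoothLaw_map_nearestCount,
        individualLaw_eq m (hB j) (hB2 j) (hB1 j) (hΘ ρ ρ.2)]
  · refine deficiency_pi_mixture_le w
      (fun _ => (smoothKernel m).comap _ hcountAvg)
      (fun j => Kernel.deterministic _ (measurable_frequencyVec m (B j)))
      (fun ρ j => ?_) (fun ρ j => ?_) hε (fun ρ j => (haff ρ j).symm) n
    · rw [bind_comap, individualLaw_map_count hm (hB j) (hB2 j) (hB1 j) (hΘ ρ ρ.2)]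
      rfl
    · rw [bind_deterministic, fineRegressionLaw_eq hm (hB j) (hB2 j) (hΘ ρ ρ.2)]

end Bounds

/-! ### The design mass of the nondegenerate observables -/

/-- The fraction of the Pauli observables with at least two proper cells. -/
def pauliMass (b : ℕ) (ρ : Matrix (Fin b → Fin 2) (Fin b → Fin 2) ℂ) : ℝ :=
  (1 / (4 : ℝ) ^ b) * ∑ l : Fin b → Fin 4,
    (if 2 ≤ (properCells (pauli b l) ρ).ncard then 1 else 0)

lemma nondegenerateMass_unifDesign (b : ℕ) (ρ : Matrix (Fin b → Fin 2) (Fin b → Fin 2) ℂ) :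
    nondegenerateMass (pauli b) (unifDesign b) ρ = pauliMass b ρ := by
  rw [nondegenerateMass, pauliMass, Finset.mul_sum]
  refine Finset.sum_congr rfl fun l _ => ?_
  congr 1
  simp [unifDesign]

lemma pauliMass_eq_card (b : ℕ) (ρ : Matrix (Fin b → Fin 2) (Fin b → Fin 2) ℂ) :
    pauliMass b ρ = (1 / (4 : ℝ) ^ b) * ((Finset.univ.filter fun l : Fin b → Fin 4 =>
      2 ≤ (properCells (pauli b l) ρ).ncard).card : ℝ) := by
  rw [pauliMass, Finset.sum_boole]

lemma card_pauli_index (b : ℕ) : ((Finset.univ : Finset (Fin b → Fin 4)).card : ℝ) = 4 ^ b := by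
  simp

lemma pauliMass_le_one (b : ℕ) (ρ : Matrix (Fin b → Fin 2) (Fin b → Fin 2) ℂ) :
    pauliMass b ρ ≤ 1 := by
  rw [pauliMass_eq_card, one_div_mul_eq_div, div_le_one (by positivity), ← card_pauli_index]
  exact_mod_cast Finset.card_le_card (Finset.filter_subset _ _)

/-- The mass is determined by the cardinality of a subset of the index set. -/
lemma finite_range_pauliMass (b : ℕ) (s : Set (Matrix (Fin b → Fin 2) (Fin b → Fin 2) ℂ)) :
    (pauliMass b '' s).Finite := by
  refine ((Set.finite_range fun t : Finset (Fin b → Fin 4) =>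
    (1 / (4 : ℝ) ^ b) * (t.card : ℝ))).subset ?_
  rintro _ ⟨ρ, -, rfl⟩
  exact ⟨_, (pauliMass_eq_card b ρ).symm⟩

lemma pauliMass_productState (b : ℕ) : pauliMass b (productState b) = 1 - 1 / (4 : ℝ) ^ b := by
  have h : (Finset.univ.filter fun l : Fin b → Fin 4 =>
      2 ≤ (properCells (pauli b l) (productState b)).ncard) = Finset.univ.erase 0 := by
    ext l
    simp only [Finset.mem_filter, Finset.mem_univ, true_and, Finset.mem_erase, and_true]
    rw [two_le_ncard_properCells_pauli_iff (productState_isDensity b).2]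
    exact ⟨fun h => h.1, fun h => ⟨h, successProb_productState h⟩⟩
  rw [pauliMass_eq_card, h, Finset.cast_card_erase_of_mem (Finset.mem_univ _), card_pauli_index]
  field_simp

lemma isGreatest_zeta (b r : ℕ) (hr : 1 ≤ r) :
    IsGreatest (pauliMass b '' lowRankStates (Fin b → Fin 2) r)
      (zeta (pauli b) (unifDesign b) (unifDesign b) (lowRankStates (Fin b → Fin 2) r)) := by
  have hz : zeta (pauli b) (unifDesign b) (unifDesign b) (lowRankStates (Fin b → Fin 2) r) =
      sSup (pauliMass b '' lowRankStates (Fin b → Fin 2) r) := by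
    simp only [zeta, max_self, nondegenerateMass_unifDesign]
    rw [sSup_image']
  have hf := finite_range_pauliMass b (lowRankStates (Fin b → Fin 2) r)
  rw [hz]
  refine ⟨Set.Nonempty.csSup_mem ⟨_, productState b,
    ⟨productState_isDensity b, ?_⟩, rfl⟩ hf, fun x hx => le_csSup hf.bddAbove hx⟩
  rw [productState_rank]
  exact hr

end QTomo

end

open QTomo in
theorem corollary3 :
    (∀ b r : ℕ, 1 ≤ r →
      IsGreatest
        ((fun ρ : Matrix (Fin b → Fin 2) (Fin b → Fin 2) ℂ =>
            (1 / (4 : ℝ) ^ b) * ∑ l : Fin b → Fin 4,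
              (if 2 ≤ (properCells (pauli b l) ρ).ncard then 1 else 0)) ''
          lowRankStates (Fin b → Fin 2) r)
        (zeta (pauli b) (unifDesign b) (unifDesign b) (lowRankStates (Fin b → Fin 2) r)) ∧
      zeta (pauli b) (unifDesign b) (unifDesign b) (lowRankStates (Fin b → Fin 2) r) ≤ 1 ∧
      1 - 1 / (4 : ℝ) ^ b ≤
        zeta (pauli b) (unifDesign b) (unifDesign b) (lowRankStates (Fin b → Fin 2) r) ∧
      IsDensity (productState b) ∧ (productState b).rank = 1 ∧
      (1 / (4 : ℝ) ^ b) * ∑ l : Fin b → Fin 4,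
          (if 2 ≤ (properCells (pauli b l) (productState b)).ncard then 1 else 0) =
        1 - 1 / (4 : ℝ) ^ b) ∧
    (∀ c₀ c₁ : ℝ, 0 < c₀ → c₀ ≤ c₁ → c₁ < 1 → ∃ C : ℝ, 0 < C ∧
      ∀ (b r m n : ℕ), 0 < m →
      ∀ Θ : Set (Matrix (Fin b → Fin 2) (Fin b → Fin 2) ℂ),
        Θ ⊆ lowRankStates (Fin b → Fin 2) r → CellBounds (pauli b) c₀ c₁ Θ →
        deficiencyDist
            (fun ρ : Θ => traceRegression (pauli b) (unifDesign b) m n ρ)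
            (fun ρ : Θ => tomographySummarized (pauli b) (unifDesign b) m n ρ) ≤
          ENNReal.ofReal (C * Real.sqrt ((n : ℝ) / m)) ∧
        deficiencyDist
            (fun ρ : Θ => fineTraceRegression (pauli b) (unifDesign b) m n ρ)
            (fun ρ : Θ => tomographyIndividual (pauli b) (unifDesign b) m n ρ) ≤
          ENNReal.ofReal (C * Real.sqrt ((n : ℝ) / m))) := by
  refine ⟨fun b r hr => ?_, fun c₀ c₁ h0 h01 h1 => ?_⟩
  · have hg := isGreatest_zeta b r hr
    obtain ⟨ρ, -, hρ⟩ := hg.1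
    refine ⟨hg, ?_, ?_, productState_isDensity b, productState_rank b, pauliMass_productState b⟩
    · rw [← hρ]
      exact pauliMass_le_one b ρ
    · rw [← pauliMass_productState b]
      exact hg.2 ⟨productState b, ⟨productState_isDensity b, (productState_rank b).trans_le hr⟩, rfl⟩
  · have hκ : 0 < min c₀ (1 - c₁) := lt_min h0 (by linarith)
    -- From √(2nε) with ε = 5/(κ²m) and κ = min(c₀, 1 - c₁).
    refine ⟨Real.sqrt 10 / min c₀ (1 - c₁), by positivity, fun b r m n hm Θ hΘ hb => ?_⟩
    have hmr : (0 : ℝ) < m := by exact_mod_cast hm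
    have hd : ∀ ρ ∈ Θ, IsDensity ρ := fun ρ hρ => (hΘ hρ).1
    have e : Real.sqrt 10 / min c₀ (1 - c₁) * Real.sqrt ((n : ℝ) / m) =
        Real.sqrt (2 * (n * (5 / (min c₀ (1 - c₁) ^ 2 * m)))) := by
      rw [show 2 * ((n : ℝ) * (5 / (min c₀ (1 - c₁) ^ 2 * m))) =
        10 / min c₀ (1 - c₁) ^ 2 * (n / m) by field_simp; ring,
        Real.sqrt_mul (by positivity), Real.sqrt_div (by norm_num : (0 : ℝ) ≤ 10) (_ ^ 2),
        Real.sqrt_sq hκ.le]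
    rw [e]
    exact deficiencyDist_regression_tomography_le (unifDesign b) n (pauli_isHermitian b)
      (pauli_mul_self b) (pauli_ne_neg_one b) hd hm hκ fun ρ hρ j =>
        successProb_degenerate_or_bounds (pauli_isHermitian b) (pauli_mul_self b)
          (pauli_ne_neg_one b) hd hb hρ j
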